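/- Let $E$ be a finite linearly ordered set and let $M\to N$ be an oriented matroid perspective on $E$, i.e. $M$ and $N$ are oriented matroids on the ground set $E$ such that every signed circuit of $M$ is a vector of $N$ (a conformal union of signed circuits of $N$). Let $r_M, r_N$ be the rank functions of the underlying matroids, put $r(M)=r_M(E)$ and $r(N)=r_N(E)$, and let $$t(M,N;x,y,z)=\sum_{A\subseteq E}(x-1)^{r(N)-r_N(A)}\,(y-1)^{|A|-r_M(A)}\,z^{\,r(M)-r(N)-(r_M(A)-r_N(A))}$$ be the Tutte polynomial of the perspective. For an oriented matroid $L$ on $E$, let $O(L)$ be the set of all elements $\min(C)$ with $C$ a positive circuit of $L$, and let $O^*(L)$ be the set of all elements $\min(D)$ with $D$ a positive cocircuit of $L$. For $A\subseteq E$, let $-_AL$ be the oriented matroid obtained from $L$ by reversing the signs of the elements of $A$, and put $$\Theta_L(A)=O(-_AL)\setminus A,\quad \bar\Theta_L(A)=O(-_AL)\cap A,\quad \Theta^*_L(A)=O^*(-_AL)\setminus A,\quad \bar\Theta^*_L(A)=O^*(-_AL)\cap A.$$ Then $$t(M,N;x+u,y+v,1)=\sum_{A\subseteq E}x^{|\Theta^*_N(A)|}\,u^{|\bar\Theta^*_N(A)|}\,y^{|\Theta_M(A)|}\,v^{|\bar\Theta_M(A)|}$$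 as an identity of polynomials in $x,u,y,v$ with integer coefficients; equivalently, for all values of $x,u,y,v$ in any commutative ring. -/

import Mathlib

/-! ### Signed sets

A signed set (or signed subset) on `E` is a map `X : E → SignType`: its positive part is `{e | X e = 1}`, its
negative part is `{e | X e = -1}`, and its support is `Function.support X = {e | X e ≠ 0}`. -/

/-- Two signed sets are conformal if they have the same signs on the intersection of their
supports. -/
def SignedConformal {E : Type*} (X Y : E → SignType) : Prop :=
  ∀ e, X e ≠ 0 → Y e ≠ 0 → X e = Y e

/-- Two signed sets are orthogonal if either their supports are disjoint, or they have both an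
element with equal (nonzero) signs and an element with opposite (nonzero) signs. -/
def SignedOrthogonal {E : Type*} (X Y : E → SignType) : Prop :=
  (∃ e, X e * Y e = 1) ↔ (∃ e, X e * Y e = -1)

/-- A signed set is positive if it has no negative element. -/
def SignedPositive {E : Type*} (X : E → SignType) : Prop :=
  ∀ e, X e ≠ -1

/-- `V` is the conformal union of the family `T` of pairwise conformal signed sets. -/
def IsConformalUnion {E : Type*} (T : Set (E → SignType)) (V : E → SignType) : Prop :=
  (∀ X ∈ T, ∀ Y ∈ T, SignedConformal X Y) ∧
    ∀ e : E, ∀ s : SignType, s ≠ 0 → (V e = s ↔ ∃ X ∈ T, X e = s)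

/-- The signed set obtained from `X` by reversing the signs of the elements of `A`. -/
def signedReorient {E : Type*} [DecidableEq E] (A : Finset E) (X : E → SignType) : E → SignType :=
  fun e => if e ∈ A then -X e else X e

theorem signedReorient_involutive {E : Type*} [DecidableEq E] (A : Finset E) (X : E → SignType) :
    signedReorient A (signedReorient A X) = X := by
  funext e
  by_cases h : e ∈ A <;> simp [signedReorient, h]

theorem signedReorient_neg {E : Type*} [DecidableEq E] (A : Finset E) (X : E → SignType) :
    signedReorient A (-X) = -signedReorient A X := by
  funext e
  by_cases h : e ∈ A <;> simp [signedReorient, h]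

theorem support_signedReorient {E : Type*} [DecidableEq E] (A : Finset E) (X : E → SignType) :
    Function.support (signedReorient A X) = Function.support X := by
  ext e
  by_cases h : e ∈ A <;> simp [signedReorient, h]

/-! ### Oriented matroids -/

/-- An oriented matroid on the (finite) ground set `E`, given by its signed circuits. -/
@[ext]
structure OrientedMatroid (E : Type*) where
  /-- The set of signed circuits. -/
  circuits : Set (E → SignType)
  zero_notMem : (0 : E → SignType) ∉ circuits
  neg_mem : ∀ X ∈ circuits, -X ∈ circuits
  incomparable : ∀ X ∈ circuits, ∀ Y ∈ circuits,
    Function.support X ⊆ Function.support Y → X = Y ∨ X = -Y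
  /-- Weak elimination: the positive and the negative part of `Z` are contained in the union of
  the corresponding parts of `X` and `Y`, with `e` removed. -/
  elimination : ∀ X ∈ circuits, ∀ Y ∈ circuits, X ≠ -Y → ∀ e, X e = 1 → Y e = -1 →
    ∃ Z ∈ circuits, Z e = 0 ∧
      (∀ f, Z f = 1 → X f = 1 ∨ Y f = 1) ∧ (∀ f, Z f = -1 → X f = -1 ∨ Y f = -1)

namespace OrientedMatroid

/-- Unsigned circuit elimination. -/
theorem exists_circuit_of_mem_support {E : Type*} (M : OrientedMatroid E) {X Y : E → SignType}
    (hX : X ∈ M.circuits) (hY : Y ∈ M.circuits)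
    (hne : Function.support X ≠ Function.support Y) {e : E} (heX : X e ≠ 0) (heY : Y e ≠ 0) :
    ∃ Z ∈ M.circuits,
      Function.support Z ⊆ (Function.support X ∪ Function.support Y) \ {e} := by
  have key : ∀ X' ∈ M.circuits, ∀ Y' ∈ M.circuits,
      Function.support X' = Function.support X → Function.support Y' = Function.support Y →
      X' e = 1 → Y' e = -1 → ∃ Z ∈ M.circuits,
        Function.support Z ⊆ (Function.support X ∪ Function.support Y) \ {e} := by
    intro X' hX' Y' hY' hsX hsY h1 h2
    have hne' : X' ≠ -Y' := by
      rintro rfl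
      apply hne
      rw [← hsX, ← hsY]
      ext f
      simp
    obtain ⟨Z, hZ, hZe, hZp, hZn⟩ := M.elimination X' hX' Y' hY' hne' e h1 h2
    refine ⟨Z, hZ, fun f hf => ⟨?_, ?_⟩⟩
    · rw [← hsX, ← hsY]
      rcases SignType.trichotomy (Z f) with h | h | h
      · rcases hZn f h with h' | h'
        · left; simp [h']
        · right; simp [h']
      · exact absurd h hf
      · rcases hZp f h with h' | h'
        · left; simp [h']
        · right; simp [h']
    · rintro rfl
      exact hf hZe
  have sX : Function.support (-X) = Function.support X := by ext f; simp
  have sY : Function.support (-Y) = Function.support Y := by ext f; simp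
  have nX := M.neg_mem X hX
  have nY := M.neg_mem Y hY
  rcases SignType.trichotomy (X e) with h | h | h <;>
    rcases SignType.trichotomy (Y e) with h' | h' | h'
  · exact key (-X) nX Y hY sX rfl (by simp [h]) h'
  · exact absurd h' heY
  · exact key (-X) nX (-Y) nY sX sY (by simp [h]) (by simp [h'])
  · exact absurd h heX
  · exact absurd h heX
  · exact absurd h heX
  · exact key X hX Y hY rfl rfl h h'
  · exact absurd h' heY
  · exact key X hX (-Y) nY rfl sY h (by simp [h'])

/-- A set is independent if it contains the support of no signed circuit. -/
def IsIndep {E : Type*} (M : OrientedMatroid E) (I : Set E) : Prop :=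
  ∀ X ∈ M.circuits, ¬ Function.support X ⊆ I

theorem IsIndep.augment {E : Type*} [Finite E] {M : OrientedMatroid E} {I J : Set E}
    (hI : M.IsIndep I) (hJ : M.IsIndep J) (hIJ : I.ncard < J.ncard) :
    ∃ e ∈ J, e ∉ I ∧ M.IsIndep (insert e I) := by
  classical
  by_contra hcon
  push Not at hcon
  let S : Set (Set E) := {K | M.IsIndep K ∧ K ⊆ I ∪ J ∧ I.ncard < K.ncard}
  have hS : S.Nonempty := ⟨J, hJ, Set.subset_union_right, hIJ⟩
  obtain ⟨K, ⟨hK, hKsub, hKcard⟩, hmin⟩ :=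
    Set.exists_min_image S (fun K => (I \ K).ncard) (Set.toFinite S) hS
  have hKI : (K \ I).Nonempty := by
    rw [Set.nonempty_iff_ne_empty]
    intro h
    rw [Set.sdiff_eq_empty] at h
    exact absurd (Set.ncard_le_ncard h (Set.toFinite I)) (not_le.2 hKcard)
  have hIK : (I \ K).Nonempty := by
    rw [Set.nonempty_iff_ne_empty]
    intro h
    rw [Set.sdiff_eq_empty] at h
    obtain ⟨f, hfK, hfI⟩ := hKI
    have hfJ : f ∈ J := (hKsub hfK).resolve_left hfI
    refine hcon f hfJ hfI fun X hX hXs => hK X hX (hXs.trans ?_)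
    exact Set.insert_subset hfK h
  obtain ⟨e, heI, heK⟩ := hIK
  have circ : ∀ f ∈ K \ I, ∃ X ∈ M.circuits,
      Function.support X ⊆ insert e K \ {f} ∧ X e ≠ 0 := by
    rintro f ⟨hfK, hfI⟩
    have hef : e ≠ f := by rintro rfl; exact hfI heI
    by_contra hno
    push Not at hno
    have hT : M.IsIndep (insert e K \ {f}) := by
      intro X hX hXs
      refine hK X hX fun g hg => ?_
      rcases (hXs hg).1 with rfl | h
      · exact absurd (hno X hX hXs) hg
      · exact h
    have hTS : (insert e K \ {f}) ∈ S := by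
      refine ⟨hT, ?_, ?_⟩
      · rintro g ⟨rfl | hg, -⟩
        · exact Or.inl heI
        · exact hKsub hg
      · rw [Set.ncard_sdiff_singleton_of_mem (Set.mem_insert_of_mem e hfK),
          Set.ncard_insert_of_notMem heK (Set.toFinite K)]
        simpa using hKcard
    have h1 := hmin _ hTS
    have h2 : (I \ (insert e K \ {f})).ncard < (I \ K).ncard := by
      apply Set.ncard_lt_ncard _ (Set.toFinite _)
      refine ⟨?_, ?_⟩
      · rintro g ⟨hgI, hg⟩
        refine ⟨hgI, fun hgK => hg ⟨Or.inr hgK, ?_⟩⟩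
        rintro rfl
        exact hfI hgI
      · intro h
        exact (h ⟨heI, heK⟩).2 ⟨Or.inl rfl, hef⟩
    exact absurd h1 (not_le.2 h2)
  obtain ⟨g, hg⟩ := hKI
  obtain ⟨X, hX, hXs, hXe⟩ := circ g hg
  have : ∃ h ∈ K \ I, X h ≠ 0 := by
    by_contra hno
    push Not at hno
    refine hI X hX fun f hf => ?_
    rcases (hXs hf).1 with rfl | hfK
    · exact heI
    · by_contra hfI
      exact hf (hno f ⟨hfK, hfI⟩)
  obtain ⟨h, hh, hXh⟩ := this
  obtain ⟨Y, hY, hYs, hYe⟩ := circ h hh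
  have hne : Function.support X ≠ Function.support Y := by
    intro heq
    have : h ∈ Function.support Y := heq ▸ hXh
    exact (hYs this).2 rfl
  obtain ⟨Z, hZ, hZs⟩ := M.exists_circuit_of_mem_support hX hY hne hXe hYe
  refine hK Z hZ fun f hf => ?_
  obtain ⟨hf1, hf2⟩ := hZs hf
  rcases hf1 with h' | h'
  · exact (hXs h').1.resolve_left hf2
  · exact (hYs h').1.resolve_left hf2

/-- The underlying matroid: its independent sets are the sets containing the support of no signed
circuit, so its circuits are the supports of the signed circuits
(see `toMatroid_isCircuit_iff`). -/
def toMatroid {E : Type*} [Finite E] (M : OrientedMatroid E) : Matroid E :=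
  (IndepMatroid.ofFinite (E := Set.univ) Set.finite_univ M.IsIndep
    (fun X hX hs => M.zero_notMem (by
      rw [Set.subset_empty_iff, Function.support_eq_empty_iff] at hs
      exact hs ▸ hX))
    (fun _ _ hJ hIJ X hX hs => hJ X hX (hs.trans hIJ))
    (fun _ _ hI hJ hIJ => hI.augment hJ hIJ)
    (fun _ _ => Set.subset_univ _)).matroid

theorem toMatroid_indep_iff {E : Type*} [Finite E] (M : OrientedMatroid E) (I : Set E) :
    M.toMatroid.Indep I ↔ M.IsIndep I := Iff.rfl

theorem toMatroid_isCircuit_iff {E : Type*} [Finite E] (M : OrientedMatroid E) (C : Set E) :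
    M.toMatroid.IsCircuit C ↔ ∃ X ∈ M.circuits, Function.support X = C := by
  rw [Matroid.isCircuit_iff_forall_ssubset, Matroid.dep_iff]
  constructor
  · rintro ⟨⟨hd, -⟩, hmin⟩
    rw [toMatroid_indep_iff, IsIndep] at hd
    push Not at hd
    obtain ⟨X, hX, hXC⟩ := hd
    refine ⟨X, hX, ?_⟩
    by_contra hne
    exact hmin (hXC.ssubset_of_ne hne) X hX subset_rfl
  · rintro ⟨X, hX, rfl⟩
    refine ⟨⟨fun h => h X hX subset_rfl, Set.subset_univ _⟩, fun I hI Y hY hYI => ?_⟩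
    have hs : Function.support X = Function.support Y := by
      rcases M.incomparable Y hY X hX (hYI.trans hI.subset) with rfl | rfl
      · rfl
      · ext f; simp
    exact hI.2 (hs ▸ hYI)

/-- The rank function of (the underlying matroid of) an oriented matroid. -/
noncomputable def rk {E : Type*} [Finite E] (M : OrientedMatroid E) (A : Set E) : ℕ :=
  (M.toMatroid.eRk A).toNat

/-- The signed cocircuits of an oriented matroid, that is, the signed circuits of the dual oriented
matroid: the signed sets that are orthogonal to all signed circuits, and whose support is a
cocircuit of the underlying matroid. -/
def cocircuits {E : Type*} [Finite E] (M : OrientedMatroid E) : Set (E → SignType) :=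
  {D | M.toMatroid.IsCocircuit (Function.support D) ∧ ∀ X ∈ M.circuits, SignedOrthogonal D X}

/-- The vectors of an oriented matroid are the conformal unions of circuits. -/
def IsVector {E : Type*} (M : OrientedMatroid E) (V : E → SignType) : Prop :=
  ∃ T ⊆ M.circuits, IsConformalUnion T V

/-- `(M, N)` is an oriented matroid perspective `M → N` (a strong map, or quotient): any circuit
of `M` is a vector of `N`. -/
def IsPerspective {E : Type*} (M N : OrientedMatroid E) : Prop :=
  ∀ X ∈ M.circuits, N.IsVector X

/-- The reorientation `-_A M`. -/
def reorient {E : Type*} [DecidableEq E] (M : OrientedMatroid E) (A : Finset E) :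
    OrientedMatroid E where
  circuits := signedReorient A '' M.circuits
  zero_notMem := by
    rintro ⟨X, hX, h⟩
    have h0 : X = 0 := by
      rw [← Function.support_eq_empty_iff, ← support_signedReorient A X, h,
        Function.support_zero]
    exact M.zero_notMem (h0 ▸ hX)
  neg_mem := by
    rintro _ ⟨X, hX, rfl⟩
    exact ⟨-X, M.neg_mem X hX, signedReorient_neg A X⟩
  incomparable := by
    rintro _ ⟨X, hX, rfl⟩ _ ⟨Y, hY, rfl⟩ h
    rw [support_signedReorient, support_signedReorient] at h
    rcases M.incomparable X hX Y hY h with rfl | rfl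
    · exact Or.inl rfl
    · exact Or.inr (signedReorient_neg A Y)
  elimination := by
    rintro _ ⟨X, hX, rfl⟩ _ ⟨Y, hY, rfl⟩ hne e hXe hYe
    have hne' : X ≠ -Y := fun h => hne (by rw [h, signedReorient_neg])
    have conv : ∃ Z ∈ M.circuits, Z e = 0 ∧
        (∀ f, Z f = 1 → X f = 1 ∨ Y f = 1) ∧ (∀ f, Z f = -1 → X f = -1 ∨ Y f = -1) := by
      by_cases he : e ∈ A
      · simp only [signedReorient, he, if_true] at hXe hYe
        have hX1 : X e = -1 := by rw [← neg_neg (X e), hXe]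
        have hY1 : Y e = 1 := by rw [← neg_neg (Y e), hYe, neg_neg]
        obtain ⟨Z, hZ, h0, hp, hn⟩ := M.elimination Y hY X hX
          (fun h => hne' (by rw [h, neg_neg])) e hY1 hX1
        exact ⟨Z, hZ, h0, fun f hf => (hp f hf).symm, fun f hf => (hn f hf).symm⟩
      · simp only [signedReorient, he, if_false] at hXe hYe
        exact M.elimination X hX Y hY hne' e hXe hYe
    obtain ⟨Z, hZ, h0, hp, hn⟩ := conv
    refine ⟨_, ⟨Z, hZ, rfl⟩, by simp [signedReorient, h0], fun f => ?_, fun f => ?_⟩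
    · by_cases hf : f ∈ A
      · simp only [signedReorient, hf, if_true]
        intro h
        have := hn f (by rw [← neg_neg (Z f), h])
        rcases this with h | h <;> simp [h]
      · simpa only [signedReorient, hf, if_false] using hp f
    · by_cases hf : f ∈ A
      · simp only [signedReorient, hf, if_true]
        intro h
        have := hp f (by rw [← neg_neg (Z f), h, neg_neg])
        rcases this with h | h <;> simp [h]
      · simpa only [signedReorient, hf, if_false] using hn f

/-! ### Activities -/

open scoped Classical in
/-- `O(M)`, the set of active elements: the smallest elements of positive circuits. -/
noncomputable def active {E : Type*} [Fintype E] [LinearOrder E] (M : OrientedMatroid E) :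
    Finset E :=
  Finset.univ.filter fun e =>
    ∃ C ∈ M.circuits, SignedPositive C ∧ IsLeast (Function.support C) e

open scoped Classical in
/-- `O*(M)`, the set of dual-active elements: the smallest elements of positive cocircuits. -/
noncomputable def dualActive {E : Type*} [Fintype E] [LinearOrder E] (M : OrientedMatroid E) :
    Finset E :=
  Finset.univ.filter fun e =>
    ∃ D ∈ M.cocircuits, SignedPositive D ∧ IsLeast (Function.support D) e

/-- `Θ_M(A) = O(-_A M) \ A`. -/
noncomputable def theta {E : Type*} [Fintype E] [LinearOrder E] (M : OrientedMatroid E)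
    (A : Finset E) : Finset E :=
  (M.reorient A).active \ A

/-- `Θ̄_M(A) = O(-_A M) ∩ A`. -/
noncomputable def thetaBar {E : Type*} [Fintype E] [LinearOrder E] (M : OrientedMatroid E)
    (A : Finset E) : Finset E :=
  (M.reorient A).active ∩ A

/-- `Θ*_M(A) = O*(-_A M) \ A`. -/
noncomputable def thetaStar {E : Type*} [Fintype E] [LinearOrder E] (M : OrientedMatroid E)
    (A : Finset E) : Finset E :=
  (M.reorient A).dualActive \ A

/-- `Θ̄*_M(A) = O*(-_A M) ∩ A`. -/
noncomputable def thetaStarBar {E : Type*} [Fintype E] [LinearOrder E] (M : OrientedMatroid E)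
    (A : Finset E) : Finset E :=
  (M.reorient A).dualActive ∩ A

/-! ### The Tutte polynomial -/

/-- The Tutte polynomial `t(M, N; x, y, z)` of a pair `(M, N)`, evaluated in a commutative ring.
The exponents are natural numbers; for a perspective the subtractions never truncate, as
`0 ≤ r_M(A) - r_N(A) ≤ r(M) - r(N)` for all `A`. -/
noncomputable def tutte {E : Type*} [Fintype E] {R : Type*} [CommRing R]
    (M N : OrientedMatroid E) (x y z : R) : R :=
  ∑ A : Finset E,
    (x - 1) ^ (N.rk Set.univ - N.rk (A : Set E)) *
    (y - 1) ^ (A.card - M.rk (A : Set E)) *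
    z ^ ((M.rk Set.univ - N.rk Set.univ) - (M.rk (A : Set E) - N.rk (A : Set E)))

end OrientedMatroid

/-!
The proof replaces orientations by minors one element at a time. Let `e` be the greatest element that
is still oriented. Every smaller active element of the two orientations of `e` is governed by circuits
of four kinds: those fitting the first orientation, those fitting the second one, those avoiding `e`
(the deletion of `e`), and those with an arbitrary sign at `e` (the contraction of `e`). Strong circuit
elimination shows that an element is active in the deletion if and only if it is active in both
orientations, and in the contraction if and only if it is active in at least one. It also shows that
the active sets of the two orientations are comparable, so that they are, in some order, those of the
deletion and of the contraction.

Dual activity is brought into the same form by a Farkas lemma (`mem_dualActive_iff`): `f` is the least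
element of a positive cocircuit unless some circuit through `f` is nonnegative from `f` on. Such
obstructing circuits obey the same elimination argument. Since a circuit of `M` is a vector of `N`, an
orientation that gains an active element of `M` cannot lose an obstruction in `N`, and so the pairing
of the two orientations with the two minors is the same for both activities
(`orientation_pair_eq_minor_pair`). Hence replacing the two orientations of `e` by its deletion and its
contraction preserves the sum of the weights, with the factor `y + v - 1` for a contracted loop of `M`
and `x + u - 1` for a deleted coloop of `N` (`prod_stageFactor_add`).

Once every element has been removed, a subset `A` records which elements were contracted; the loops
met on the way number `|A| - r_M(A)` and the coloops `r(N) - r_N(A)`, which is the expansion defining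
the Tutte polynomial.

Only two facts about oriented matroids enter besides the axioms. Strong elimination
(`exists_strong_elimination`) is derived from weak elimination by induction on the size of the union of
two circuits. The Farkas lemma (`exists_positive_cocircuit`) follows from strong elimination by choosing
a minimal obstructing set and applying Gaussian elimination to the circuits that witness its minimality.
All minors are expressed through circuits of the original oriented matroid that vanish on the deleted
set and are unconstrained on the contracted one (`Hits`).
-/

namespace OrientedMatroid

/-! ### Strong elimination -/

/-- Weak elimination in a form symmetric under change of signs. -/
theorem exists_weak_elimination {E : Type*} (M : OrientedMatroid E) {X Y : E → SignType}
    (hX : X ∈ M.circuits) (hY : Y ∈ M.circuits) (hne : X ≠ -Y) {e : E} (heX : X e ≠ 0)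
    (heY : Y e = -X e) :
    ∃ Z ∈ M.circuits, Z e = 0 ∧ ∀ q, Z q = 0 ∨ Z q = X q ∨ Z q = Y q := by
  have key : ∀ X' ∈ M.circuits, ∀ Y' ∈ M.circuits, X' ≠ -Y' → X' e = 1 → Y' e = -1 →
      ∃ Z ∈ M.circuits, Z e = 0 ∧ ∀ q, Z q = 0 ∨ Z q = X' q ∨ Z q = Y' q := by
    intro X' hX' Y' hY' hne' h1 h2
    obtain ⟨Z, hZ, hZe, hp, hn⟩ := M.elimination X' hX' Y' hY' hne' e h1 h2
    refine ⟨Z, hZ, hZe, fun q => ?_⟩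
    rcases SignType.trichotomy (Z q) with h | h | h
    · exact Or.inr ((hn q h).imp (fun h' => h.trans h'.symm) fun h' => h.trans h'.symm)
    · exact Or.inl h
    · exact Or.inr ((hp q h).imp (fun h' => h.trans h'.symm) fun h' => h.trans h'.symm)
  rcases SignType.trichotomy (X e) with h | h | h
  · obtain ⟨Z, hZ, hZe, hq⟩ := key Y hY X hX (fun h' => hne (by rw [h', neg_neg]))
      (by rw [heY, h, neg_neg]) h
    exact ⟨Z, hZ, hZe, fun q => (hq q).imp_right Or.symm⟩
  · exact absurd h heX
  · exact key X hX Y hY hne h (by rw [heY, h])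

/-- A circuit missing an element of another circuit is not contained in it. -/
theorem exists_mem_support_notMem {E : Type*} (M : OrientedMatroid E) {X Z : E → SignType}
    (hX : X ∈ M.circuits) (hZ : Z ∈ M.circuits) {e : E} (heX : X e ≠ 0) (heZ : Z e = 0) :
    ∃ g, Z g ≠ 0 ∧ X g = 0 := by
  by_contra! h
  rcases M.incomparable Z hZ X hX (fun g hg => h g hg) with rfl | rfl
  · exact heX heZ
  · exact heX (by simpa using heZ)

/-- If `Z' f ≠ 0` and the signs of `Z'` not borrowed from `X` or `Y` are all opposite to the signs of
`Z`, then eliminating these places between `Z'` and `Z` leaves a circuit through `f` whose signs are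
all borrowed from `X` and `Y`. -/
theorem exists_circuit_of_cancel {E : Type*} [Finite E] (M : OrientedMatroid E)
    {X Y Z : E → SignType} {e f : E} (hZ : Z ∈ M.circuits) (hZe : Z e = 0) (hZf : Z f = 0)
    (hZq : ∀ q, Z q = 0 ∨ Z q = X q ∨ Z q = Y q) (heX : X e ≠ 0)
    (strong : ∀ X' ∈ M.circuits, ∀ Y' ∈ M.circuits,
      (Function.support X' ∪ Function.support Y').ncard <
        (Function.support X ∪ Function.support Y).ncard →
      ∀ e' f', X' e' ≠ 0 → Y' e' = -X' e' → X' f' ≠ 0 → Y' f' ≠ -X' f' →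
      ∃ W ∈ M.circuits, W e' = 0 ∧ W f' = X' f' ∧ ∀ q, W q = 0 ∨ W q = X' q ∨ W q = Y' q)
    (n : ℕ) : ∀ Z' ∈ M.circuits, Z' e = 0 → Z' f ≠ 0 →
      (∀ q, Z' q = 0 ∨ Z' q = X q ∨ Z' q = Y q ∨ Z' q = -Z q) →
      {q | ¬(Z' q = 0 ∨ Z' q = X q ∨ Z' q = Y q)}.ncard = n →
      ∃ W ∈ M.circuits, W e = 0 ∧ W f = Z' f ∧ ∀ q, W q = 0 ∨ W q = X q ∨ W q = Y q := by
  induction n using Nat.strong_induction_on with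
  | _ n ih =>
    intro Z' hZ' he' hf' hq' hn
    by_cases hgood : ∀ q, Z' q = 0 ∨ Z' q = X q ∨ Z' q = Y q
    · exact ⟨Z', hZ', he', rfl, hgood⟩
    rw [not_forall] at hgood
    obtain ⟨p, hp⟩ := hgood
    have hpZ : Z' p = -Z p := by have := hq' p; tauto
    have hp0 : Z' p ≠ 0 := fun h => hp (Or.inl h)
    have hcard : (Function.support Z' ∪ Function.support Z).ncard <
        (Function.support X ∪ Function.support Y).ncard := by
      refine Set.ncard_lt_ncard ⟨?_, fun h => ?_⟩ (Set.toFinite _)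
      · intro q hq
        have h1 : Z q ≠ 0 → X q ≠ 0 ∨ Y q ≠ 0 := fun hz => by
          rcases hZq q with h | h | h
          · exact absurd h hz
          · exact Or.inl (h ▸ hz)
          · exact Or.inr (h ▸ hz)
        rcases hq with hq | hq
        · rcases hq' q with h | h | h | h
          · exact absurd h hq
          · exact Or.inl fun hx => hq (h.trans hx)
          · exact Or.inr fun hx => hq (h.trans hx)
          · exact h1 fun hz => hq (by rw [h, hz, neg_zero])
        · exact h1 hq
      · rcases h (Or.inl heX) with h | h
        · exact h he'
        · exact h hZe
    obtain ⟨W, hW, hWp, hWf, hWq⟩ := strong Z' hZ' Z hZ hcard p f hp0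
      (by rw [hpZ, neg_neg]) hf' (by rw [hZf]; intro h; exact hf' (by simpa using h.symm))
    have hWe : W e = 0 := by rcases hWq e with h | h | h <;> simp [h, he', hZe]
    rw [← hWf]
    refine ih _ ?_ W hW hWe (by rwa [hWf]) (fun q => ?_) rfl
    · rw [← hn]
      refine Set.ncard_lt_ncard ⟨?_, fun h => ?_⟩ (Set.toFinite _)
      · intro q hq hc
        rcases hWq q with h | h | h
        · exact hq (Or.inl h)
        · exact hq (by rwa [h])
        · exact hq (by rw [h]; exact hZq q)
      · exact h hp (Or.inl hWp)
    · rcases hWq q with h | h | h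
      · exact Or.inl h
      · rw [h]; exact hq' q
      · rw [h]; have := hZq q; tauto

/-- Strong elimination: eliminating `e` between two circuits, a given element `f` of the first one
can be kept, provided the second one does not carry the opposite sign there. The proof is by
induction on the size of the union of the two supports. -/
theorem exists_strong_elimination {E : Type*} [Finite E] (M : OrientedMatroid E)
    {X Y : E → SignType} (hX : X ∈ M.circuits) (hY : Y ∈ M.circuits) {e f : E} (heX : X e ≠ 0)
    (heY : Y e = -X e) (hfX : X f ≠ 0) (hfY : Y f ≠ -X f) :
    ∃ Z ∈ M.circuits, Z e = 0 ∧ Z f = X f ∧ ∀ q, Z q = 0 ∨ Z q = X q ∨ Z q = Y q := by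
  induction hn : (Function.support X ∪ Function.support Y).ncard using Nat.strong_induction_on
    generalizing X Y e f with
  | _ n ih =>
    subst hn
    have strong : ∀ X' ∈ M.circuits, ∀ Y' ∈ M.circuits,
        (Function.support X' ∪ Function.support Y').ncard <
          (Function.support X ∪ Function.support Y).ncard →
        ∀ e' f', X' e' ≠ 0 → Y' e' = -X' e' → X' f' ≠ 0 → Y' f' ≠ -X' f' →
        ∃ W ∈ M.circuits, W e' = 0 ∧ W f' = X' f' ∧ ∀ q, W q = 0 ∨ W q = X' q ∨ W q = Y' q :=
      fun X' hX' Y' hY' hlt e' f' h1 h2 h3 h4 => ih _ hlt hX' hY' h1 h2 h3 h4 rfl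
    have hcard : ∀ X' Y' : E → SignType, ∀ p, X' p = 0 → Y' p = 0 → (X p ≠ 0 ∨ Y p ≠ 0) →
        (∀ q, X q = 0 → Y q = 0 → X' q = 0 ∧ Y' q = 0) →
        (Function.support X' ∪ Function.support Y').ncard <
          (Function.support X ∪ Function.support Y).ncard := by
      intro X' Y' p h1 h2 h3 h4
      refine Set.ncard_lt_ncard ⟨?_, fun h => ?_⟩ (Set.toFinite _)
      · intro q hq
        by_contra hc
        simp only [Set.mem_union, Function.mem_support, not_or, not_not] at hc
        have := h4 q hc.1 hc.2
        rcases hq with hq | hq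
        · exact hq this.1
        · exact hq this.2
      · rcases h h3 with h | h
        · exact h h1
        · exact h h2
    have hne : X ≠ -Y := by
      rintro rfl
      exact hfY (by simp)
    obtain ⟨Z, hZ, hZe, hZq⟩ := M.exists_weak_elimination hX hY hne heX heY
    by_cases hZf : Z f ≠ 0
    · refine ⟨Z, hZ, hZe, ?_, hZq⟩
      have h1 := hZq f
      generalize Z f = a, X f = b, Y f = c at *
      revert a b c
      decide
    push Not at hZf
    -- It suffices to find a circuit `Z'` through `f` that avoids `e` and errs only against `Z`.
    suffices h : ∃ Z' ∈ M.circuits, Z' e = 0 ∧ Z' f = X f ∧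
        ∀ q, Z' q = 0 ∨ Z' q = X q ∨ Z' q = Y q ∨ Z' q = -Z q by
      obtain ⟨Z', hZ', he', hf', hq'⟩ := h
      obtain ⟨W, hW, h1, h2, h3⟩ := M.exists_circuit_of_cancel hZ hZe hZf hZq heX strong _ Z' hZ'
        he' (by rwa [hf']) hq' rfl
      exact ⟨W, hW, h1, h2.trans hf', h3⟩
    have hneg : ∀ {a : SignType}, a ≠ 0 → (0 : SignType) ≠ -a := by decide
    have heY0 : Y e ≠ 0 := by rw [heY]; simpa using heX
    have hnZ := M.neg_mem Z hZ
    have hZ0 : ∀ q, X q = 0 → Y q = 0 → Z q = 0 := fun q h1 h2 => by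
      rcases hZq q with h | h | h <;> simp [h, h1, h2]
    -- For this it is enough to have a circuit `Y'` that agrees with `Y` at `e`, errs only against `Z`,
    -- and avoids an element `g` of `Y` outside `X`: the induction hypothesis applies to `X` and `Y'`.
    have finish : ∀ Y' ∈ M.circuits, Y' e = Y e → Y' f ≠ -X f → ∀ g, Y' g = 0 → X g = 0 → Y g ≠ 0 →
        (∀ q, Y' q = 0 ∨ Y' q = X q ∨ Y' q = Y q ∨ Y' q = -Z q) →
        ∃ Z' ∈ M.circuits, Z' e = 0 ∧ Z' f = X f ∧
          ∀ q, Z' q = 0 ∨ Z' q = X q ∨ Z' q = Y q ∨ Z' q = -Z q := by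
      intro Y' hY' he' hf' g hg hgX hgY hq'
      obtain ⟨W, hW, h1, h2, h3⟩ := strong X hX Y' hY'
        (hcard X Y' g hgX hg (Or.inr hgY) fun q hx hy => ⟨hx, by
          rcases hq' q with h | h | h | h <;> simp [h, hx, hy, hZ0 q hx hy]⟩) e f heX
          (by rw [he', heY]) hfX hf'
      refine ⟨W, hW, h1, h2, fun q => ?_⟩
      rcases h3 q with h | h | h
      · exact Or.inl h
      · exact Or.inr (Or.inl h)
      · rw [h]; exact hq' q
    by_cases hfY0 : Y f = 0
    -- If `f` is not in `Y`, then `Y` and `Z` both avoid `f`, and the induction hypothesis applies to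
    -- `Y` and `-Z`, at an element `g` outside `X`.
    · obtain ⟨g, hgZ, hgX⟩ := M.exists_mem_support_notMem hX hZ heX hZe
      have hgY : Z g = Y g := by
        rcases hZq g with h | h | h
        · exact absurd h hgZ
        · exact absurd (h.trans hgX) hgZ
        · exact h
      obtain ⟨Y', hY', h1, h2, h3⟩ := strong Y hY (-Z) hnZ
        (hcard Y (-Z) f hfY0 (by simp [hZf]) (Or.inl hfX) fun q hx hy =>
          ⟨hy, by simp [hZ0 q hx hy]⟩) g e (hgY ▸ hgZ) (by simp [hgY]) heY0
          (by simpa only [Pi.neg_apply, hZe, neg_zero] using hneg heY0)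
      refine finish Y' hY' h2 ?_ g h1 hgX (hgY ▸ hgZ) fun q => ?_
      · have : Y' f = 0 := by rcases h3 f with h | h | h <;> simp [h, hfY0, hZf]
        rw [this]
        exact hneg hfX
      · have := h3 q
        simp only [Pi.neg_apply] at this
        tauto
    · have hfXY : Y f = X f := by
        have : ∀ {a b : SignType}, a ≠ 0 → b ≠ 0 → b ≠ -a → b = a := by decide
        exact this hfX hfY0 hfY
      -- Eliminate between `X` and `-Z` at an element `h` outside `Y`: the result `X'` avoids `h`, so
      -- the induction hypothesis applies to `Y` and `X'`.
      obtain ⟨h, hhZ, hhY⟩ := M.exists_mem_support_notMem hY hZ heY0 hZe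
      have hhX : Z h = X h := by
        rcases hZq h with h' | h' | h'
        · exact absurd h' hhZ
        · exact h'
        · exact absurd (h'.trans hhY) hhZ
      obtain ⟨X', hX', h1, h2⟩ := M.exists_weak_elimination hX hnZ
        (fun hc => heX (by rw [hc]; simp [hZe])) (e := h) (hhX ▸ hhZ) (by simp [hhX])
      have hX'0 : ∀ q, X q = 0 → Y q = 0 → X' q = 0 := fun q hx hy => by
        rcases h2 q with h' | h' | h' <;> simp [h', hx, hZ0 q hx hy]
      have hX'e : X' e = 0 ∨ X' e = X e := by
        rcases h2 e with h' | h' | h' <;> simp [h', hZe]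
      have hX'f : X' f = 0 ∨ X' f = X f := by
        rcases h2 f with h' | h' | h' <;> simp [h', hZf]
      rcases hX'e with hX'e | hX'e
      · rcases hX'f with hX'f | hX'f
        -- Here `X'` avoids both `e` and `f`; it still errs against `Z` at some `g` outside `X`, where
        -- it can be used in place of `-Z` to modify `Y`.
        · obtain ⟨g, hgX', hgX⟩ := M.exists_mem_support_notMem hX hX' heX hX'e
          have hg1 : X' g = -Z g := by
            rcases h2 g with h' | h' | h'
            · exact absurd h' hgX'
            · exact absurd (h'.trans hgX) hgX'
            · exact h'
          have hgZ : Z g ≠ 0 := fun hc => hgX' (by simp [hg1, hc])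
          have hgY : Z g = Y g := by
            rcases hZq g with h' | h' | h'
            · exact absurd h' hgZ
            · exact absurd (h'.trans hgX) hgZ
            · exact h'
          obtain ⟨Y', hY', k1, k2, k3⟩ := strong Y hY X' hX'
            (hcard Y X' h hhY h1 (Or.inl (hhX ▸ hhZ)) fun q hx hy => ⟨hy, hX'0 q hx hy⟩) g e
            (hgY ▸ hgZ) (by rw [hg1, hgY]) heY0 (by rw [hX'e]; exact hneg heY0)
          refine finish Y' hY' k2 ?_ g k1 hgX (hgY ▸ hgZ) fun q => ?_
          · rcases k3 f with h' | h' | h'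
            · rw [h']; exact hneg hfX
            · rw [h']; exact hfY
            · rw [h', hX'f]; exact hneg hfX
          · have a1 := k3 q
            have a2 := h2 q
            simp only [Pi.neg_apply] at a2
            rcases a1 with h' | h' | h'
            · exact Or.inl h'
            · exact Or.inr (Or.inr (Or.inl h'))
            · rw [h']; tauto
        · refine ⟨X', hX', hX'e, hX'f, fun q => ?_⟩
          have := h2 q
          simp only [Pi.neg_apply] at this
          tauto
      · obtain ⟨W, hW, k1, k2, k3⟩ := strong Y hY X' hX'
          (hcard Y X' h hhY h1 (Or.inl (hhX ▸ hhZ)) fun q hx hy => ⟨hy, hX'0 q hx hy⟩) e f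
          heY0 (by rw [hX'e, heY, neg_neg]) hfY0 (by
            rw [hfXY]
            rcases hX'f with h' | h'
            · rw [h']; exact hneg hfX
            · rw [h']; rwa [hfXY] at hfY)
        refine ⟨W, hW, k1, k2.trans hfXY, fun q => ?_⟩
        have a2 := h2 q
        simp only [Pi.neg_apply] at a2
        rcases k3 q with h' | h' | h'
        · exact Or.inl h'
        · exact Or.inr (Or.inr (Or.inl h'))
        · rw [h']; tauto

/-! ### A Farkas lemma for positive cocircuits -/

theorem mem_closure_of_circuit {E : Type*} [Finite E] (M : OrientedMatroid E) {X : E → SignType}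
    (hX : X ∈ M.circuits) {e : E} (he : X e ≠ 0) {S : Set E} (hS : ∀ g, X g ≠ 0 → g ≠ e → g ∈ S) :
    e ∈ M.toMatroid.closure S := by
  by_cases heS : e ∈ S
  · exact M.toMatroid.mem_closure_of_mem heS (Set.subset_univ S)
  · refine (Matroid.mem_closure_iff_exists_isCircuit heS).2
      ⟨Function.support X, fun g hg => ?_, (M.toMatroid_isCircuit_iff _).2 ⟨X, hX, rfl⟩, he⟩
    by_cases h : g = e
    · exact Or.inl h
    · exact Or.inr (hS g hg h)

theorem mem_closure_iff_exists_circuit {E : Type*} [Finite E] (M : OrientedMatroid E) {e : E}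
    {S : Set E} (heS : e ∉ S) :
    e ∈ M.toMatroid.closure S ↔
      ∃ X ∈ M.circuits, X e ≠ 0 ∧ ∀ g, X g ≠ 0 → g ≠ e → g ∈ S := by
  refine ⟨fun h => ?_, fun ⟨X, hX, he, hS⟩ => M.mem_closure_of_circuit hX he hS⟩
  obtain ⟨C, hCS, hC, heC⟩ := (Matroid.mem_closure_iff_exists_isCircuit heS).1 h
  obtain ⟨X, hX, rfl⟩ := (M.toMatroid_isCircuit_iff _).1 hC
  exact ⟨X, hX, heC, fun g hg hge => (hCS hg).resolve_left hge⟩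

/-- If every circuit through `f` that is positive at `f` is negative somewhere on `R`, then there is a
positive cocircuit through `f` inside `R ∪ {f}`. Its support is `{f} ∪ S` for `S ⊆ R` minimal with
the same property. -/
theorem exists_positive_cocircuit {E : Type*} [Finite E] (M : OrientedMatroid E) {f : E}
    {R : Set E} (hfR : f ∉ R)
    (hR : ∀ X ∈ M.circuits, X f = 1 → ∃ g ∈ R, X g = -1) :
    ∃ D ∈ M.cocircuits, D f = 1 ∧ SignedPositive D ∧ ∀ g, D g ≠ 0 → g = f ∨ g ∈ R := by
  classical
  obtain ⟨S, hSR, hSmin⟩ := (Set.toFinite {S : Set E | ∀ X ∈ M.circuits, X f = 1 →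
    ∃ g ∈ S, X g = -1}).exists_le_minimal hR
  have hS := hSmin.prop
  have hfS : f ∉ S := fun h => hfR (hSR h)
  have hstart : ∀ e ∈ S, ∃ Y ∈ M.circuits, Y f = 1 ∧ Y e = -1 ∧
      ∀ g ∈ S, g ≠ e → Y g ≠ -1 := by
    intro e he
    have : ¬ ∀ X ∈ M.circuits, X f = 1 → ∃ g ∈ S \ {e}, X g = -1 := fun h =>
      ((hSmin.le_of_le h Set.sdiff_subset) he).2 rfl
    push Not at this
    obtain ⟨Y, hY, hYf, hYg⟩ := this
    obtain ⟨g, hg, hYg'⟩ := hS Y hY hYf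
    have hge : g = e := by
      by_contra hne
      exact hYg g ⟨hg, hne⟩ hYg'
    exact ⟨Y, hY, hYf, hge ▸ hYg', fun g hg hne => hYg g ⟨hg, hne⟩⟩
  -- Gaussian elimination: clear the elements of `T ⊆ S` one after the other.
  have hgauss : ∀ T : Finset E, (∀ g ∈ T, g ∈ S) → ∀ e ∈ S, ∃ Y ∈ M.circuits, Y f = 1 ∧ Y e = -1 ∧
      (∀ g ∈ S, g ≠ e → Y g ≠ -1) ∧ ∀ g ∈ T, g ≠ e → Y g = 0 := by
    intro T
    induction T using Finset.induction_on with
    | empty =>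
      intro _ e he
      obtain ⟨Y, hY, h1, h2, h3⟩ := hstart e he
      exact ⟨Y, hY, h1, h2, h3, by simp⟩
    | insert s T hs ih =>
      intro hT e he
      have hsS := hT s (Finset.mem_insert_self s T)
      have ih := ih fun g hg => hT g (Finset.mem_insert_of_mem hg)
      obtain ⟨Y, hY, h1, h2, h3, h4⟩ := ih e he
      by_cases hdone : s = e ∨ Y s = 0
      · refine ⟨Y, hY, h1, h2, h3, fun g hg hge => ?_⟩
        rcases Finset.mem_insert.1 hg with rfl | hg
        · exact hdone.resolve_left hge
        · exact h4 g hg hge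
      push Not at hdone
      have hYs : Y s = 1 := by
        rcases SignType.trichotomy (Y s) with h | h | h
        · exact absurd h (h3 s hsS hdone.1)
        · exact absurd h hdone.2
        · exact h
      obtain ⟨Z, hZ, k1, k2, k3, k4⟩ := ih s hsS
      obtain ⟨W, hW, w1, w2, w3⟩ := M.exists_strong_elimination hY hZ (e := s) (f := f) hdone.2
        (by rw [hYs, k2]) (by rw [h1]; decide) (by rw [h1, k1]; decide)
      have hWg : ∀ g ∈ S, g ≠ e → W g ≠ -1 := by
        intro g hg hge
        by_cases hgs : g = s
        · rw [hgs, w1]; decide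
        rcases w3 g with h | h | h
        · rw [h]; decide
        · rw [h]; exact h3 g hg hge
        · rw [h]; exact k3 g hg hgs
      refine ⟨W, hW, w2.trans h1, ?_, hWg, fun g hg hge => ?_⟩
      · obtain ⟨g, hg, hgW⟩ := hS W hW (w2.trans h1)
        by_cases hge : g = e
        · exact hge ▸ hgW
        · exact absurd hgW (hWg g hg hge)
      · by_cases hgs : g = s
        · exact hgs ▸ w1
        have hgT := (Finset.mem_insert.1 hg).resolve_left hgs
        rcases w3 g with h | h | h
        · exact h
        · rw [h]; exact h4 g hgT hge
        · rw [h]; exact k4 g hgT hgs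
  have hpair : ∀ e ∈ S, ∃ Z ∈ M.circuits, Z f = 1 ∧ Z e = -1 ∧ ∀ g ∈ S, g ≠ e → Z g = 0 := by
    intro e he
    obtain ⟨Z, hZ, h1, h2, -, h3⟩ := hgauss (Set.toFinite S).toFinset (by simp) e he
    exact ⟨Z, hZ, h1, h2, fun g hg => h3 g (by simpa using hg)⟩
  -- A circuit that is nonnegative on `{f} ∪ S` vanishes there.
  have hzero : ∀ X ∈ M.circuits, X f ≠ -1 → (∀ g ∈ S, X g ≠ -1) →
      ∀ g, g = f ∨ g ∈ S → X g ≠ 1 := by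
    rintro X hX hXf hXS d hd hXd
    rcases hd with rfl | hd
    · obtain ⟨g, hg, hgX⟩ := hS X hX hXd
      exact hXS g hg hgX
    obtain ⟨Z, hZ, h1, h2, h3⟩ := hpair d hd
    obtain ⟨W, hW, w1, w2, w3⟩ := M.exists_strong_elimination hZ hX (e := d) (f := f)
      (by rw [h2]; decide) (by rw [hXd, h2]; decide) (by rw [h1]; decide) (by rwa [h1])
    obtain ⟨g, hg, hgW⟩ := hS W hW (w2.trans h1)
    by_cases hgd : g = d
    · rw [hgd, w1] at hgW
      exact absurd hgW (by decide)
    · rcases w3 g with h | h | h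
      · rw [h] at hgW; exact absurd hgW (by decide)
      · rw [h, h3 g hg hgd] at hgW; exact absurd hgW (by decide)
      · exact hXS g hg (h ▸ hgW)
  have hsupp : Function.support (fun g => if g = f ∨ g ∈ S then (1 : SignType) else 0) =
      insert f S := by
    ext g
    simp only [Function.mem_support, Set.mem_insert_iff]
    split_ifs with h <;> simp [h]
  refine ⟨fun g => if g = f ∨ g ∈ S then 1 else 0, ⟨?_, fun X hX => ?_⟩, by simp, fun g => ?_,
    fun g hg => ?_⟩
  · rw [hsupp, Matroid.isCocircuit_iff_minimal_compl_nonspanning,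
      Set.minimal_iff_forall_ssubset]
    have hground : M.toMatroid.E = Set.univ := rfl
    have hfcl : f ∉ M.toMatroid.closure (M.toMatroid.E \ insert f S) := by
      rw [M.mem_closure_iff_exists_circuit (by simp)]
      rintro ⟨X, hX, hXf, hXg⟩
      have hX0 : ∀ g ∈ S, X g = 0 := by
        intro g hg
        by_contra h
        exact (hXg g h fun h' => hfS (h' ▸ hg)).2 (Or.inr hg)
      have key : ∀ X' ∈ M.circuits, (∀ g ∈ S, X' g = 0) → X' f ≠ 1 := by
        intro X' hX' h0 h1
        obtain ⟨g, hg, hgX⟩ := hS X' hX' h1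
        rw [h0 g hg] at hgX
        exact absurd hgX (by decide)
      rcases SignType.trichotomy (X f) with h | h | h
      · exact key (-X) (M.neg_mem X hX) (fun g hg => by simp [hX0 g hg]) (by simp [h])
      · exact hXf h
      · exact key X hX hX0 h
    refine ⟨fun h => hfcl ?_, fun D' hD' hns => hns ?_⟩
    · rw [h.closure_eq]; exact Set.mem_univ f
    · obtain ⟨e, heD, heD'⟩ := Set.exists_of_ssubset hD'
      set H := M.toMatroid.E \ insert f S with hH
      have hfe : f ∈ M.toMatroid.closure (insert e H) := by
        rcases heD with rfl | heS
        · exact M.toMatroid.mem_closure_of_mem (Set.mem_insert _ _) (Set.subset_univ _)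
        · obtain ⟨Z, hZ, h1, h2, h3⟩ := hpair e heS
          refine M.mem_closure_of_circuit hZ (by rw [h1]; decide) fun g hg hgf => ?_
          by_cases hge : g = e
          · exact Or.inl hge
          · refine Or.inr ⟨Set.mem_univ g, ?_⟩
            rintro (h | h)
            · exact hgf h
            · exact hg (h3 g h hge)
      have hall : ∀ d, d ∈ M.toMatroid.closure (insert e H) := by
        intro d
        have hsub : insert f H ⊆ M.toMatroid.closure (insert e H) :=
          Set.insert_subset hfe ((Set.subset_insert e H).trans
            (M.toMatroid.subset_closure _ (Set.subset_univ _)))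
        refine M.toMatroid.closure_subset_closure_of_subset_closure hsub ?_
        by_cases hd : d ∈ S
        · obtain ⟨Z, hZ, h1, h2, h3⟩ := hpair d hd
          refine M.mem_closure_of_circuit hZ (by rw [h2]; decide) fun g hg hgd => ?_
          by_cases hgf : g = f
          · exact Or.inl hgf
          · refine Or.inr ⟨Set.mem_univ g, ?_⟩
            rintro (h | h)
            · exact hgf h
            · exact hg (h3 g h hgd)
        · refine M.toMatroid.mem_closure_of_mem ?_ (Set.subset_univ _)
          by_cases hdf : d = f
          · exact Or.inl hdf
          · exact Or.inr ⟨Set.mem_univ d, fun h => h.elim hdf hd⟩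
      have hsp : M.toMatroid.Spanning (insert e H) := by
        rw [Matroid.spanning_iff]
        exact ⟨Set.eq_univ_of_forall hall, Set.subset_univ _⟩
      refine hsp.superset ?_ Set.sdiff_subset
      refine Set.insert_subset ⟨Set.mem_univ e, heD'⟩ fun g hg => ⟨hg.1, fun h => hg.2 (hD'.1 h)⟩
  · have hmul : ∀ (X : E → SignType) (s : SignType), s ≠ 0 →
        ((∃ g, (if g = f ∨ g ∈ S then (1 : SignType) else 0) * X g = s) ↔
          ∃ g, (g = f ∨ g ∈ S) ∧ X g = s) := by
      intro X s hs
      refine exists_congr fun g => ?_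
      split_ifs with h
      · simp [h]
      · simpa [h] using hs.symm
    rw [SignedOrthogonal, hmul X 1 (by decide), hmul X (-1) (by decide)]
    constructor
    · rintro ⟨g, hg, hgX⟩
      by_contra! hc
      exact hzero X hX (hc f (Or.inl rfl)) (fun g hg => hc g (Or.inr hg)) g hg hgX
    · rintro ⟨g, hg, hgX⟩
      by_contra! hc
      have hc' : ∀ g, g = f ∨ g ∈ S → (-X) g ≠ -1 := fun g hg h => hc g hg (by simpa using h)
      exact hzero (-X) (M.neg_mem X hX) (hc' f (Or.inl rfl)) (fun g hg => hc' g (Or.inr hg)) g hg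
        (by simp [hgX])
  · dsimp only
    split_ifs <;> decide
  · by_contra h
    exact hg (if_neg fun h' => h (h'.imp_right fun h'' => hSR h''))

/-- Minty-type alternative for dual activity: `f` is the least element of a positive cocircuit if and
only if no circuit is positive at `f` and nonnegative above `f`. -/
theorem mem_dualActive_iff {E : Type*} [Fintype E] [LinearOrder E] (M : OrientedMatroid E) {f : E} :
    f ∈ M.dualActive ↔ ∀ X ∈ M.circuits, X f = 1 → ∃ g, f < g ∧ X g = -1 := by
  simp only [dualActive, Finset.mem_filter, Finset.mem_univ, true_and]
  constructor
  · rintro ⟨D, hD, hpos, hfD, hleast⟩ X hX hXf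
    have hD01 : ∀ g, D g = 0 ∨ D g = 1 := fun g => by
      rcases SignType.trichotomy (D g) with h | h | h
      · exact absurd h (hpos g)
      · exact Or.inl h
      · exact Or.inr h
    have hDf : D f = 1 := (hD01 f).resolve_left hfD
    obtain ⟨g, hg⟩ := (hD.2 X hX).1 ⟨f, by rw [hDf, hXf, one_mul]⟩
    have hDg : D g = 1 := (hD01 g).resolve_left fun h => by
      rw [h, zero_mul] at hg; exact absurd hg (by decide)
    rw [hDg, one_mul] at hg
    refine ⟨g, lt_of_le_of_ne (hleast (by simp [hDg])) ?_, hg⟩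
    rintro rfl
    rw [hXf] at hg
    exact absurd hg (by decide)
  · intro h
    obtain ⟨D, hD, hDf, hpos, hg⟩ := M.exists_positive_cocircuit (f := f) (R := Set.Ioi f)
      (by simp) h
    refine ⟨D, hD, hpos, by simp [hDf], fun g hg' => ?_⟩
    rcases hg g hg' with rfl | h
    · exact le_rfl
    · exact le_of_lt h

/-! ### Circuits of reoriented minors -/

theorem signedReorient_zero_iff {E : Type*} [DecidableEq E] (A : Finset E) (X : E → SignType)
    (g : E) : signedReorient A X g = 0 ↔ X g = 0 := by
  by_cases h : g ∈ A <;> simp [signedReorient, h]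

theorem signedReorient_congr {E : Type*} [DecidableEq E] {A B : Finset E} (X : E → SignType)
    {g : E} (h : g ∈ A ↔ g ∈ B) : signedReorient A X g = signedReorient B X g := by
  simp only [signedReorient, h]

/-- `X` vanishes on `Δ` and, after reorientation along `A`, is nonnegative off `T`. -/
def Fits {E : Type*} [DecidableEq E] (A : Finset E) (T Δ : Set E) (X : E → SignType) : Prop :=
  (∀ g ∈ Δ, X g = 0) ∧ ∀ g ∉ T, signedReorient A X g ≠ -1

/-- Some circuit through `f` vanishes on `Δ` and is nonnegative off `T` after reorientation along `A`.
For `f ∉ T` this says that `f` lies on a positive circuit of the reorientation along `A` of the minor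
in which `Δ` is deleted and `T` is contracted. -/
def Hits {E : Type*} [DecidableEq E] (M : OrientedMatroid E) (A : Finset E) (T Δ : Set E) (f : E) :
    Prop :=
  ∃ X ∈ M.circuits, X f ≠ 0 ∧ Fits A T Δ X

section Fits

variable {E : Type*} [DecidableEq E] {A B : Finset E} {T Δ T' Δ' : Set E} {X : E → SignType} {e f : E}

theorem Fits.mono (h : Fits A T Δ X) (hT : T ⊆ T') (hΔ : Δ' ⊆ Δ) : Fits A T' Δ' X :=
  ⟨fun g hg => h.1 g (hΔ hg), fun g hg => h.2 g fun h' => hg (hT h')⟩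

theorem Fits.conformal {Y : E → SignType} (h : Fits A T Δ X) (hY : ∀ g, Y g = 0 ∨ Y g = X g) :
    Fits A T Δ Y := by
  refine ⟨fun g hg => ?_, fun g hg => ?_⟩
  · rcases hY g with h' | h'
    · exact h'
    · exact h'.trans (h.1 g hg)
  · rcases hY g with h' | h'
    · rw [(signedReorient_zero_iff A Y g).2 h']; decide
    · have := h.2 g hg
      simpa only [signedReorient, h'] using this

/-- Reorienting along `A` or along `B` makes no difference to a signed set that vanishes at the only
element at which `A` and `B` may differ. -/
theorem Fits.of_eq_zero (h : Fits A T Δ X) (hAB : ∀ g, g ≠ e → (g ∈ A ↔ g ∈ B)) (he : X e = 0) :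
    Fits B T (insert e Δ) X := by
  refine ⟨fun g hg => ?_, fun g hg => ?_⟩
  · rcases hg with rfl | hg
    · exact he
    · exact h.1 g hg
  · by_cases hge : g = e
    · rw [hge, (signedReorient_zero_iff B X e).2 he]; decide
    · rw [← signedReorient_congr X (hAB g hge)]; exact h.2 g hg

theorem Fits.insert_left (h : Fits A T Δ X) (hAB : ∀ g, g ≠ e → (g ∈ A ↔ g ∈ B)) :
    Fits B (insert e T) Δ X := by
  refine ⟨h.1, fun g hg => ?_⟩
  have hge : g ≠ e := fun h' => hg (Or.inl h')
  rw [← signedReorient_congr X (hAB g hge)]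
  exact h.2 g fun h' => hg (Or.inr h')

theorem Fits.of_insert_left (h : Fits A (insert e T) Δ X) (he : signedReorient A X e ≠ -1) :
    Fits A T Δ X := by
  refine ⟨h.1, fun g hg => ?_⟩
  by_cases hge : g = e
  · rwa [hge]
  · exact h.2 g fun h' => h'.elim hge hg

end Fits

theorem Hits.of_delete {E : Type*} [DecidableEq E] {M : OrientedMatroid E} {A B : Finset E}
    {T Δ : Set E} {e f : E} (h : Hits M A T (insert e Δ) f)
    (hAB : ∀ g, g ≠ e → (g ∈ A ↔ g ∈ B)) : Hits M B T Δ f := by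
  obtain ⟨X, hX, hf, hfit⟩ := h
  exact ⟨X, hX, hf, (hfit.of_eq_zero hAB (hfit.1 e (Or.inl rfl))).mono subset_rfl
    ((Set.subset_insert e Δ).trans (Set.subset_insert e _))⟩

theorem Hits.contract {E : Type*} [DecidableEq E] {M : OrientedMatroid E} {A B : Finset E}
    {T Δ : Set E} {e f : E} (h : Hits M A T Δ f)
    (hAB : ∀ g, g ≠ e → (g ∈ A ↔ g ∈ B)) : Hits M B (insert e T) Δ f := by
  obtain ⟨X, hX, hf, hfit⟩ := h
  exact ⟨X, hX, hf, hfit.insert_left hAB⟩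

/-- A circuit of the contraction of `e` comes from a circuit in one of the two orientations of `e`. -/
theorem Hits.of_contract {E : Type*} [DecidableEq E] {M : OrientedMatroid E} {A B : Finset E}
    {T Δ : Set E} {e f : E} (h : Hits M B (insert e T) Δ f)
    (hAB : ∀ g, g ≠ e → (g ∈ A ↔ g ∈ B)) (he : e ∈ A ↔ e ∉ B) :
    Hits M A T Δ f ∨ Hits M B T Δ f := by
  obtain ⟨X, hX, hf, hfit⟩ := h
  have hsign : signedReorient A X e = -signedReorient B X e := by
    by_cases h : e ∈ B <;> simp [signedReorient, h, he]
  by_cases h : signedReorient B X e = -1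
  · refine Or.inl ⟨X, hX, hf, Fits.of_insert_left ?_ (by rw [hsign, h]; decide)⟩
    simpa using hfit.insert_left fun g hg => (hAB g hg).symm
  · exact Or.inr ⟨X, hX, hf, hfit.of_insert_left h⟩

/-- A circuit through `f` and one through `e` that fit the two opposite orientations of `e` can be
combined to a circuit through `f` in the deletion of `e`. -/
theorem Hits.delete_of_circuit {E : Type*} [DecidableEq E] [Finite E] {M : OrientedMatroid E}
    {A B C : Finset E} {T Δ : Set E} {e f : E} (h : Hits M B T Δ f) {X : E → SignType}
    (hX : X ∈ M.circuits) (hXe : X e ≠ 0) (hfit : Fits A T Δ X)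
    (hAB : ∀ g, g ≠ e → (g ∈ A ↔ g ∈ B)) (he : e ∈ A ↔ e ∉ B)
    (hBC : ∀ g, g ≠ e → (g ∈ B ↔ g ∈ C)) (heT : e ∉ T) (hfT : f ∉ T) (hfe : f ≠ e) :
    Hits M C T (insert e Δ) f := by
  obtain ⟨Y, hY, hYf, hYfit⟩ := h
  by_cases hYe : Y e = 0
  · exact ⟨Y, hY, hYf, hYfit.of_eq_zero hBC hYe⟩
  have h1 : X e = -Y e := by
    have a1 := hfit.2 e heT
    have a2 := hYfit.2 e heT
    have key : ∀ a b : SignType, a ≠ 0 → b ≠ 0 → -a ≠ -1 → b ≠ -1 → a = -b := by decide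
    have key' : ∀ a b : SignType, a ≠ 0 → b ≠ 0 → a ≠ -1 → -b ≠ -1 → a = -b := by decide
    by_cases h : e ∈ B
    · simp only [signedReorient, h, he, not_true, if_true, if_false] at a1 a2
      exact key' _ _ hXe hYe a1 a2
    · simp only [signedReorient, h, he, not_false_eq_true, if_true, if_false] at a1 a2
      exact key _ _ hXe hYe a1 a2
  have h2 : X f ≠ -Y f := by
    have a1 := hfit.2 f hfT
    have a2 := hYfit.2 f hfT
    have key : ∀ a b : SignType, b ≠ 0 → -a ≠ -1 → -b ≠ -1 → a ≠ -b := by decide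
    have key' : ∀ a b : SignType, b ≠ 0 → a ≠ -1 → b ≠ -1 → a ≠ -b := by decide
    by_cases h : f ∈ B
    · simp only [signedReorient, h, (hAB f hfe), if_true] at a1 a2
      exact key _ _ hYf a1 a2
    · simp only [signedReorient, h, (hAB f hfe), if_false] at a1 a2
      exact key' _ _ hYf a1 a2
  obtain ⟨Z, hZ, hZe, hZf, hZq⟩ := M.exists_strong_elimination hY hX hYe h1 hYf h2
  refine ⟨Z, hZ, by rwa [hZf], Fits.of_eq_zero (A := B) ⟨fun g hg => ?_, fun g hg => ?_⟩ hBC hZe⟩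
  · rcases hZq g with h | h | h
    · exact h
    · rw [h, hYfit.1 g hg]
    · rw [h, hfit.1 g hg]
  · by_cases hge : g = e
    · rw [hge, (signedReorient_zero_iff B Z e).2 hZe]; decide
    have a1 := hfit.2 g hg
    have a2 := hYfit.2 g hg
    rw [signedReorient_congr X (hAB g hge)] at a1
    rcases hZq g with h | h | h
    · rw [(signedReorient_zero_iff B Z g).2 h]; decide
    · simpa only [signedReorient, h] using a2
    · simpa only [signedReorient, h] using a1

/-- A circuit through `f` in both orientations of `e` yields one in the deletion of `e`. -/
theorem Hits.delete {E : Type*} [DecidableEq E] [Finite E] {M : OrientedMatroid E}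
    {A B C : Finset E} {T Δ : Set E} {e f : E} (hA : Hits M A T Δ f) (hB : Hits M B T Δ f)
    (hAB : ∀ g, g ≠ e → (g ∈ A ↔ g ∈ B)) (he : e ∈ A ↔ e ∉ B)
    (hBC : ∀ g, g ≠ e → (g ∈ B ↔ g ∈ C)) (heT : e ∉ T) (hfT : f ∉ T) (hfe : f ≠ e) :
    Hits M C T (insert e Δ) f := by
  obtain ⟨X, hX, hXf, hfit⟩ := hA
  by_cases hXe : X e = 0
  · exact ⟨X, hX, hXf, hfit.of_eq_zero (fun g hg => (hAB g hg).trans (hBC g hg)) hXe⟩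
  · exact hB.delete_of_circuit hX hXe hfit hAB he hBC heT hfT hfe

/-- If `e` is a loop of the minor, then deleting and contracting `e` amount to the same. -/
theorem Hits.delete_of_loop {E : Type*} [DecidableEq E] [Finite E] {M : OrientedMatroid E}
    {A B C : Finset E} {T Δ : Set E} {e f : E} (h : Hits M B (insert e T) Δ f)
    {X : E → SignType} (hX : X ∈ M.circuits) (hXe : X e ≠ 0) (hXΔ : ∀ g ∈ Δ, X g = 0)
    (hXT : ∀ g ∉ T, g ≠ e → X g = 0)
    (hAB : ∀ g, g ≠ e → (g ∈ A ↔ g ∈ B)) (he : e ∈ A ↔ e ∉ B)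
    (hBC : ∀ g, g ≠ e → (g ∈ B ↔ g ∈ C)) (heT : e ∉ T) (hfT : f ∉ T) (hfe : f ≠ e) :
    Hits M C T (insert e Δ) f := by
  have hsign : ∀ A : Finset E, ∃ X' ∈ M.circuits, X' e ≠ 0 ∧ Fits A T Δ X' := by
    intro A
    have key : ∀ Y : E → SignType, (∀ g ∈ Δ, Y g = 0) → (∀ g ∉ T, g ≠ e → Y g = 0) →
        signedReorient A Y e ≠ -1 → Fits A T Δ Y := by
      refine fun Y h1 h2 h3 => ⟨h1, fun g hg => ?_⟩
      by_cases hge : g = e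
      · rwa [hge]
      · rw [(signedReorient_zero_iff A Y g).2 (h2 g hg hge)]; decide
    by_cases h : signedReorient A X e = -1
    · refine ⟨-X, M.neg_mem X hX, by simpa using hXe, key _ (fun g hg => by simp [hXΔ g hg])
        (fun g hg hge => by simp [hXT g hg hge]) ?_⟩
      rw [signedReorient_neg, Pi.neg_apply, h]
      decide
    · exact ⟨X, hX, hXe, key X hXΔ hXT h⟩
  have hBA : ∀ g, g ≠ e → (g ∈ B ↔ g ∈ A) := fun g hg => (hAB g hg).symm
  rcases h.of_contract hAB he with h | h
  · obtain ⟨X', hX', h1, h2⟩ := hsign B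
    exact h.delete_of_circuit hX' h1 h2 hBA (by tauto) (fun g hg => (hAB g hg).trans (hBC g hg))
      heT hfT hfe
  · obtain ⟨X', hX', h1, h2⟩ := hsign A
    exact h.delete_of_circuit hX' h1 h2 hAB he hBC heT hfT hfe

/-! ### Activities in intermediate minors -/

/-- `f` is active in the minor obtained from `-_A M` by contracting `U ∩ A` and deleting `U \ A`, for
an upper set `U` with `f ∉ U`. For `U = Ioi f` it says that `f` is a loop of that minor. -/
def ActiveAt {E : Type*} [LinearOrder E] (M : OrientedMatroid E) (A : Finset E) (U : Set E)
    (f : E) : Prop :=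
  Hits M A (U ∩ A) (Set.Iio f ∪ U \ A) f

/-- The obstruction, in the sense of Minty's alternative, to `f` being dual-active in the minor
obtained from `-_A N` by contracting `U ∩ A` and deleting `U \ A`: some circuit through `f` is
nonnegative from `f` on. -/
def DualObstructedAt {E : Type*} [LinearOrder E] (N : OrientedMatroid E) (A : Finset E) (U : Set E)
    (f : E) : Prop :=
  Hits N A (Set.Iio f ∪ U ∩ A) (U \ A) f

theorem IsPerspective.exists_conformal {E : Type*} {M N : OrientedMatroid E} (hMN : M.IsPerspective N)
    {X : E → SignType} (hX : X ∈ M.circuits) {e : E} (he : X e ≠ 0) :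
    ∃ Y ∈ N.circuits, Y e ≠ 0 ∧ ∀ g, Y g = 0 ∨ Y g = X g := by
  obtain ⟨S, hS, -, hV⟩ := hMN X hX
  obtain ⟨Y, hY, hYe⟩ := (hV e (X e) he).1 rfl
  refine ⟨Y, hS hY, by rwa [hYe], fun g => ?_⟩
  by_cases hg : Y g = 0
  · exact Or.inl hg
  · exact Or.inr ((hV g (Y g) hg).2 ⟨Y, hY, rfl⟩).symm

/-- If `f` is hit for the orientation `A` but not for the orientation `B`, the witnessing
circuit passes through `e`. -/
theorem Hits.exists_circuit_of_not_hits {E : Type*} [DecidableEq E] {M : OrientedMatroid E}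
    {A B : Finset E} {T Δ : Set E} {e f : E} (h : Hits M A T Δ f) (hn : ¬Hits M B T Δ f)
    (hAB : ∀ g, g ≠ e → (g ∈ A ↔ g ∈ B)) : ∃ X ∈ M.circuits, X e ≠ 0 ∧ Fits A T Δ X := by
  obtain ⟨X, hX, hXf, hfit⟩ := h
  refine ⟨X, hX, fun hXe => hn ⟨X, hX, hXf, ?_⟩, hfit⟩
  exact (hfit.of_eq_zero hAB hXe).mono subset_rfl (Set.subset_insert e Δ)

/-- If `f` is hit for the orientation `B` and some circuit through `e` fits the orientation `A`, then
`f` is hit for `A` too. -/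
theorem Hits.of_circuit {E : Type*} [DecidableEq E] [Finite E] {M : OrientedMatroid E}
    {A B : Finset E} {T Δ : Set E} {e f : E} (h : Hits M B T Δ f) {X : E → SignType}
    (hX : X ∈ M.circuits) (hXe : X e ≠ 0) (hfit : Fits A T Δ X)
    (hAB : ∀ g, g ≠ e → (g ∈ A ↔ g ∈ B)) (he : e ∈ A ↔ e ∉ B) (heT : e ∉ T) (hfT : f ∉ T)
    (hfe : f ≠ e) : Hits M A T Δ f :=
  (h.delete_of_circuit (C := B) hX hXe hfit hAB he (fun _ _ => Iff.rfl) heT hfT hfe).of_delete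
    fun g hg => (hAB g hg).symm

/-- The two orientations of `e` do not gain incomparable sets of active elements: a circuit with the
larger minimum vanishes below the smaller one, so it can be used to eliminate `e` there. -/
theorem active_not_opposed {E : Type*} [LinearOrder E] [Finite E] {M : OrientedMatroid E}
    {A B : Finset E} {T Δ : Set E} {e f g : E} (hAB : ∀ g, g ≠ e → (g ∈ A ↔ g ∈ B))
    (he : e ∈ A ↔ e ∉ B) (heT : e ∉ T) (hfT : f ∉ T) (hgT : g ∉ T) (hfe : f < e) (hge : g < e)
    (h1 : Hits M A T (Set.Iio f ∪ Δ) f) (h2 : ¬Hits M B T (Set.Iio f ∪ Δ) f)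
    (h3 : Hits M B T (Set.Iio g ∪ Δ) g) : Hits M A T (Set.Iio g ∪ Δ) g := by
  by_contra h4
  have hBA : ∀ g, g ≠ e → (g ∈ B ↔ g ∈ A) := fun g hg => (hAB g hg).symm
  rcases lt_trichotomy f g with hfg | rfl | hfg
  · obtain ⟨X, hX, hXe, hfit⟩ := h3.exists_circuit_of_not_hits h4 hBA
    exact h2 (h1.of_circuit hX hXe
      (hfit.mono subset_rfl (Set.union_subset_union_left _ (Set.Iio_subset_Iio hfg.le)))
      hBA (by tauto) heT hfT hfe.ne)
  · exact h2 h3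
  · obtain ⟨X, hX, hXe, hfit⟩ := h1.exists_circuit_of_not_hits h2 hAB
    exact h4 (h3.of_circuit hX hXe
      (hfit.mono subset_rfl (Set.union_subset_union_left _ (Set.Iio_subset_Iio hfg.le)))
      hAB he heT hgT hge.ne)

/-- The two orientations of `e` do not gain incomparable sets of obstructions to dual activity: a
circuit obstructing at the smaller element is nonnegative from the larger one on, so it can be used to
eliminate `e` there. -/
theorem dualObstructed_not_opposed {E : Type*} [LinearOrder E] [Finite E] {N : OrientedMatroid E}
    {A B : Finset E} {T Δ : Set E} {e f g : E} (hAB : ∀ g, g ≠ e → (g ∈ A ↔ g ∈ B))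
    (he : e ∈ A ↔ e ∉ B) (heT : e ∉ T) (hfT : f ∉ T) (hgT : g ∉ T) (hfe : f < e) (hge : g < e)
    (h1 : Hits N A (Set.Iio f ∪ T) Δ f) (h2 : ¬Hits N B (Set.Iio f ∪ T) Δ f)
    (h3 : Hits N B (Set.Iio g ∪ T) Δ g) : Hits N A (Set.Iio g ∪ T) Δ g := by
  by_contra h4
  have hBA : ∀ g, g ≠ e → (g ∈ B ↔ g ∈ A) := fun g hg => (hAB g hg).symm
  rcases lt_trichotomy f g with hfg | rfl | hfg
  · obtain ⟨X, hX, hXe, hfit⟩ := h1.exists_circuit_of_not_hits h2 hAB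
    exact h4 (h3.of_circuit hX hXe
      (hfit.mono (Set.union_subset_union_left _ (Set.Iio_subset_Iio hfg.le)) subset_rfl)
      hAB he (by simp [heT, hge.le]) (by simp [hgT]) hge.ne)
  · exact h2 h3
  · obtain ⟨X, hX, hXe, hfit⟩ := h3.exists_circuit_of_not_hits h4 hBA
    exact h2 (h1.of_circuit hX hXe
      (hfit.mono (Set.union_subset_union_left _ (Set.Iio_subset_Iio hfg.le)) subset_rfl)
      hBA (by tauto) (by simp [heT, hfe.le]) (by simp [hfT]) hfe.ne)

/-- If one orientation of `e` gains an active element of `M`, then the other one does not gain an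
obstruction to dual activity in `N`: the circuit of `M` is a vector of `N`. -/
theorem active_dualObstructed_not_opposed {E : Type*} [LinearOrder E] [Finite E]
    {M N : OrientedMatroid E} (hMN : M.IsPerspective N)
    {A B : Finset E} {T Δ : Set E} {e f g : E} (hAB : ∀ g, g ≠ e → (g ∈ A ↔ g ∈ B))
    (he : e ∈ A ↔ e ∉ B) (heT : e ∉ T) (hgT : g ∉ T) (hge : g < e)
    (h1 : Hits M A T (Set.Iio f ∪ Δ) f) (h2 : ¬Hits M B T (Set.Iio f ∪ Δ) f)
    (h3 : Hits N B (Set.Iio g ∪ T) Δ g) : Hits N A (Set.Iio g ∪ T) Δ g := by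
  obtain ⟨X, hX, hXe, hfit⟩ := h1.exists_circuit_of_not_hits h2 hAB
  obtain ⟨Y, hY, hYe, hYX⟩ := hMN.exists_conformal hX hXe
  exact h3.of_circuit hY hYe
    ((hfit.conformal hYX).mono Set.subset_union_right Set.subset_union_right)
    hAB he (by simp [heT, hge.le]) (by simp [hgT]) hge.ne

/-- The contracted and deleted parts of the upper sets `Ioi e` and `Ici e`, for the two subsets `A` and
`insert e A`: adjoining `e` to the upper set deletes it in the first case and contracts it in the
second. -/
theorem stage_sets {E : Type*} [LinearOrder E] {A : Finset E} {e : E} (heA : e ∉ A) :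
    (Set.Ioi e ∩ (insert e A : Finset E) : Set E) = Set.Ioi e ∩ A ∧
    (Set.Ioi e \ (insert e A : Finset E) : Set E) = Set.Ioi e \ A ∧
    (Set.Ici e ∩ A : Set E) = Set.Ioi e ∩ A ∧
    (Set.Ici e \ A : Set E) = insert e (Set.Ioi e \ A) ∧
    (Set.Ici e ∩ (insert e A : Finset E) : Set E) = insert e (Set.Ioi e ∩ A) ∧
    (Set.Ici e \ (insert e A : Finset E) : Set E) = Set.Ioi e \ A := by
  refine ⟨?_, ?_, ?_, ?_, ?_, ?_⟩ <;> ext g <;>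
    by_cases h : g = e <;>
    simp [h, heA, le_iff_lt_or_eq, eq_comm (a := e)]

/-- The two orientations of the greatest remaining element `e` give, in some order, the activities of
the deletion and of the contraction of `e`, and this simultaneously for the activity in `M` and for
the dual activity in `N`. -/
theorem orientation_pair_eq_minor_pair {E : Type*} [LinearOrder E] [Finite E]
    {M N : OrientedMatroid E} (hMN : M.IsPerspective N) {A B : Finset E} {e : E} (heA : e ∉ A)
    (hB : B = insert e A) :
    (∀ f < e,
      (ActiveAt M A (Set.Ioi e) f ↔ ActiveAt M A (Set.Ici e) f) ∧
      (ActiveAt M B (Set.Ioi e) f ↔ ActiveAt M B (Set.Ici e) f) ∧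
      (DualObstructedAt N A (Set.Ioi e) f ↔ DualObstructedAt N A (Set.Ici e) f) ∧
      (DualObstructedAt N B (Set.Ioi e) f ↔ DualObstructedAt N B (Set.Ici e) f)) ∨
    (∀ f < e,
      (ActiveAt M A (Set.Ioi e) f ↔ ActiveAt M B (Set.Ici e) f) ∧
      (ActiveAt M B (Set.Ioi e) f ↔ ActiveAt M A (Set.Ici e) f) ∧
      (DualObstructedAt N A (Set.Ioi e) f ↔ DualObstructedAt N B (Set.Ici e) f) ∧
      (DualObstructedAt N B (Set.Ioi e) f ↔ DualObstructedAt N A (Set.Ici e) f)) := by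
  subst hB
  obtain ⟨s1, s2, s3, s4, s5, s6⟩ := stage_sets heA
  have hAB : ∀ g, g ≠ e → (g ∈ A ↔ g ∈ insert e A) := fun g hg => by simp [hg]
  have hBA : ∀ g, g ≠ e → (g ∈ insert e A ↔ g ∈ A) := fun g hg => (hAB g hg).symm
  have hAA : ∀ g, g ≠ e → (g ∈ A ↔ g ∈ A) := fun g hg => Iff.rfl
  have hBB : ∀ g, g ≠ e → (g ∈ insert e A ↔ g ∈ insert e A) := fun g hg => Iff.rfl
  have he : e ∈ A ↔ e ∉ insert e A := by simp [heA]
  have he' : e ∈ insert e A ↔ e ∉ A := by simp [heA]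
  simp only [ActiveAt, DualObstructedAt, s1, s2, s3, s4, s5, s6, Set.union_insert]
  set B := insert e A
  set T : Set E := Set.Ioi e ∩ A with hT
  set Δ : Set E := Set.Ioi e \ A
  have heT : e ∉ T := fun h => lt_irrefl e h.1
  have hfT : ∀ f < e, f ∉ T := fun f hf h => lt_asymm hf h.1
  have heT' : ∀ f < e, e ∉ Set.Iio f ∪ T := fun f hf => by simp [heT, hf.le]
  have hfT' : ∀ f < e, f ∉ Set.Iio f ∪ T := fun f hf => by simp [hfT f hf]
  have act : ∀ f < e,
      (Hits M A T (insert e (Set.Iio f ∪ Δ)) f ↔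
        Hits M A T (Set.Iio f ∪ Δ) f ∧ Hits M B T (Set.Iio f ∪ Δ) f) ∧
      (Hits M B (insert e T) (Set.Iio f ∪ Δ) f ↔
        Hits M A T (Set.Iio f ∪ Δ) f ∨ Hits M B T (Set.Iio f ∪ Δ) f) := fun f hf =>
    ⟨⟨fun h => ⟨h.of_delete hAA, h.of_delete hAB⟩,
      fun h => h.1.delete h.2 hAB he hBA heT (hfT f hf) hf.ne⟩,
    ⟨fun h => h.of_contract hAB he, fun h => h.elim (fun h => h.contract hAB)
      fun h => h.contract hBB⟩⟩
  have obs : ∀ f < e,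
      (Hits N A (Set.Iio f ∪ T) (insert e Δ) f ↔
        Hits N A (Set.Iio f ∪ T) Δ f ∧ Hits N B (Set.Iio f ∪ T) Δ f) ∧
      (Hits N B (insert e (Set.Iio f ∪ T)) Δ f ↔
        Hits N A (Set.Iio f ∪ T) Δ f ∨ Hits N B (Set.Iio f ∪ T) Δ f) := fun f hf =>
    ⟨⟨fun h => ⟨h.of_delete hAA, h.of_delete hAB⟩,
      fun h => h.1.delete h.2 hAB he hBA (heT' f hf) (hfT' f hf) hf.ne⟩,
    ⟨fun h => h.of_contract hAB he, fun h => h.elim (fun h => h.contract hAB)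
      fun h => h.contract hBB⟩⟩
  have key : ∀ {P N D C : Prop}, (D ↔ P ∧ N) → (C ↔ P ∨ N) → (N → P) → (P ↔ C) ∧ (N ↔ D) :=
    fun hD hC h => by
      rw [hD, hC]
      exact ⟨⟨Or.inl, fun h' => h'.elim id h⟩, ⟨fun h' => ⟨h h', h'⟩, fun h' => h'.2⟩⟩
  by_cases hc : ∃ f < e, (Hits M A T (Set.Iio f ∪ Δ) f ∧ ¬Hits M B T (Set.Iio f ∪ Δ) f) ∨
      (Hits N A (Set.Iio f ∪ T) Δ f ∧ ¬Hits N B (Set.Iio f ∪ T) Δ f)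
  · right
    have mono : ∀ g < e, (Hits M B T (Set.Iio g ∪ Δ) g → Hits M A T (Set.Iio g ∪ Δ) g) ∧
        (Hits N B (Set.Iio g ∪ T) Δ g → Hits N A (Set.Iio g ∪ T) Δ g) := by
      obtain ⟨f, hf, ⟨h1, h2⟩ | ⟨h1, h2⟩⟩ := hc
      · exact fun g hg =>
          ⟨active_not_opposed hAB he heT (hfT f hf) (hfT g hg) hf hg h1 h2,
          active_dualObstructed_not_opposed hMN hAB he heT (hfT g hg) hg h1 h2⟩
      · refine fun g hg => ⟨fun h => ?_,
          dualObstructed_not_opposed hAB he heT (hfT f hf) (hfT g hg) hf hg h1 h2⟩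
        by_contra hn
        exact h2 (active_dualObstructed_not_opposed hMN hBA he' heT (hfT f hf) hf h hn h1)
    intro f hf
    have h1 := key (act f hf).1 (act f hf).2 (mono f hf).1
    have h2 := key (obs f hf).1 (obs f hf).2 (mono f hf).2
    exact ⟨h1.1, h1.2, h2.1, h2.2⟩
  · left
    push Not at hc
    intro f hf
    have h1 := key ((act f hf).1.trans and_comm) ((act f hf).2.trans or_comm) (hc f hf).1
    have h2 := key ((obs f hf).1.trans and_comm) ((obs f hf).2.trans or_comm) (hc f hf).2
    exact ⟨h1.2, h1.1, h2.2, h2.1⟩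

/-! ### Summation over orientations and minors -/

/-- If `e` is a loop of the intermediate minor of `M`, deletion and contraction of `e` have the same
active elements and the same obstructions to dual activity. -/
theorem activeAt_congr_of_loop {E : Type*} [LinearOrder E] [Finite E] {M : OrientedMatroid E}
    {A : Finset E} {e : E} (heA : e ∉ A) {X : E → SignType} (hX : X ∈ M.circuits) (hXe : X e ≠ 0)
    (hX0 : ∀ g, g ≠ e → g ∉ Set.Ioi e ∩ (A : Set E) → X g = 0) {f : E} (hf : f < e) :
    (ActiveAt M A (Set.Ici e) f ↔ ActiveAt M (insert e A) (Set.Ici e) f) ∧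
    (DualObstructedAt M A (Set.Ici e) f ↔ DualObstructedAt M (insert e A) (Set.Ici e) f) := by
  obtain ⟨s1, s2, s3, s4, s5, s6⟩ := stage_sets heA
  have hAB : ∀ g, g ≠ e → (g ∈ A ↔ g ∈ insert e A) := fun g hg => by simp [hg]
  have hBA : ∀ g, g ≠ e → (g ∈ insert e A ↔ g ∈ A) := fun g hg => (hAB g hg).symm
  have he : e ∈ A ↔ e ∉ insert e A := by simp [heA]
  simp only [ActiveAt, DualObstructedAt, s3, s4, s5, s6, Set.union_insert]
  refine ⟨⟨fun h => ?_, fun h => ?_⟩, ⟨fun h => ?_, fun h => ?_⟩⟩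
  · exact (h.of_delete (B := A) fun _ _ => Iff.rfl).contract hAB
  · refine h.delete_of_loop hX hXe ?_ (fun g hg hge => hX0 g hge hg) hAB he hBA ?_ ?_ hf.ne
    · rintro g (hg | hg)
      · exact hX0 g (ne_of_lt (lt_trans hg hf)) fun h => lt_asymm (lt_trans hg hf) h.1
      · exact hX0 g (ne_of_gt hg.1) fun h => hg.2 h.2
    · exact fun h => lt_irrefl e h.1
    · exact fun h => lt_asymm hf h.1
  · exact (h.of_delete (B := A) fun _ _ => Iff.rfl).contract hAB
  · refine h.delete_of_loop hX hXe ?_ (fun g hg hge => hX0 g hge fun h => hg (Or.inr h)) hAB he hBA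
      ?_ ?_ hf.ne
    · exact fun g hg => hX0 g (ne_of_gt hg.1) fun h => hg.2 h.2
    · rintro (h | h)
      · exact lt_asymm hf h
      · exact lt_irrefl e h.1
    · rintro (h | h)
      · exact lt_irrefl f h
      · exact lt_asymm hf h.1

/-- If `e` is a coloop of the intermediate minor, deletion and contraction of `e` have the same
circuits. -/
theorem hits_congr_of_coloop {E : Type*} [DecidableEq E] {M : OrientedMatroid E} {A B : Finset E}
    {T Δ : Set E} {e f : E} (h : ∀ X ∈ M.circuits, (∀ g ∈ Δ, X g = 0) → X e = 0)
    (hAB : ∀ g, g ≠ e → (g ∈ A ↔ g ∈ B)) :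
    Hits M A T (insert e Δ) f ↔ Hits M B (insert e T) Δ f := by
  refine ⟨fun h' => (h'.of_delete (B := A) fun _ _ => Iff.rfl).contract hAB, ?_⟩
  rintro ⟨X, hX, hXf, hfit⟩
  have hXe := h X hX hfit.1
  refine ⟨X, hX, hXf, (hfit.of_insert_left ?_).of_eq_zero (fun g hg => (hAB g hg).symm) hXe⟩
  rw [(signedReorient_zero_iff B X e).2 hXe]
  decide

open scoped Classical in
/-- The weight of the subset `A` when the elements of the upper set `U` have been deleted (off `A`) or
contracted (in `A`) and those outside `U` are still oriented along `A`. An element outside `U` carries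
the variables of the activity expansion; an element of `U` carries a factor only if it was a loop
and contracted, or a coloop and deleted, at the moment of its removal. -/
noncomputable def stageFactor {E : Type*} [LinearOrder E] {R : Type*} [CommRing R]
    (M N : OrientedMatroid E) (x u y v : R) (U : Finset E) (A : Finset E) (f : E) : R :=
  if f ∈ U then
    if f ∈ A then if ActiveAt M A (Set.Ioi f) f then y + v - 1 else 1
    else if DualObstructedAt N A (Set.Ioi f) f then 1 else x + u - 1
  else
    (if ActiveAt M A U f then if f ∈ A then v else y else 1) *
      if DualObstructedAt N A U f then 1 else if f ∈ A then u else x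

/-- When every element other than `f` is deleted or contracted, the signs no longer matter. -/
theorem hits_iff_mem_closure {E : Type*} [DecidableEq E] [Finite E] {M : OrientedMatroid E}
    {A : Finset E} {T Δ : Set E} {f : E} (hfT : f ∉ T) (hΔ : ∀ g, g ∈ Δ ↔ g ≠ f ∧ g ∉ T) :
    Hits M A T Δ f ↔ f ∈ M.toMatroid.closure T := by
  rw [M.mem_closure_iff_exists_circuit hfT]
  constructor
  · rintro ⟨X, hX, hXf, hfit⟩
    refine ⟨X, hX, hXf, fun g hg hgf => ?_⟩
    by_contra hgT
    exact hg (hfit.1 g ((hΔ g).2 ⟨hgf, hgT⟩))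
  · rintro ⟨X, hX, hXf, hXT⟩
    have hX0 : ∀ g ∈ Δ, X g = 0 := by
      intro g hg
      by_contra h
      exact ((hΔ g).1 hg).2 (hXT g h ((hΔ g).1 hg).1)
    have key : ∀ Y : E → SignType, (∀ g ∈ Δ, Y g = 0) → signedReorient A Y f ≠ -1 →
        Fits A T Δ Y := by
      refine fun Y h1 h2 => ⟨h1, fun g hg => ?_⟩
      by_cases hgf : g = f
      · rwa [hgf]
      · rw [(signedReorient_zero_iff A Y g).2 (h1 g ((hΔ g).2 ⟨hgf, hg⟩))]; decide
    by_cases h : signedReorient A X f = -1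
    · refine ⟨-X, M.neg_mem X hX, by simpa using hXf, key _ (fun g hg => by simp [hX0 g hg]) ?_⟩
      rw [signedReorient_neg, Pi.neg_apply, h]
      decide
    · exact ⟨X, hX, hXf, key X hX0 h⟩

theorem activeAt_Ioi_iff {E : Type*} [LinearOrder E] [Finite E] {M : OrientedMatroid E}
    {A : Finset E} {f : E} :
    ActiveAt M A (Set.Ioi f) f ↔ f ∈ M.toMatroid.closure (Set.Ioi f ∩ A) := by
  refine hits_iff_mem_closure (fun h => lt_irrefl f h.1) fun g => ?_
  rcases lt_trichotomy g f with h | h | h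
  · simp [h, h.ne, h.le]
  · simp [h]
  · simp [h, h.ne', h.le]

theorem dualObstructedAt_Ioi_iff {E : Type*} [LinearOrder E] [Finite E] {N : OrientedMatroid E}
    {A : Finset E} {f : E} :
    DualObstructedAt N A (Set.Ioi f) f ↔
      f ∈ N.toMatroid.closure (Set.Iio f ∪ Set.Ioi f ∩ A) := by
  refine hits_iff_mem_closure ?_ fun g => ?_
  · rintro (h | h)
    · exact lt_irrefl f h
    · exact lt_irrefl f h.1
  rcases lt_trichotomy g f with h | h | h
  · simp [h, h.le]
  · simp [h]
  · simp [h, h.ne', h.le]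

theorem stageFactor_congr {E : Type*} [LinearOrder E] [Finite E] {R : Type*} [CommRing R]
    {M N : OrientedMatroid E} {x u y v : R} {U U' A A' : Finset E} {e f : E} (hfe : f ≠ e)
    (hA : ∀ g, g ≠ e → (g ∈ A ↔ g ∈ A')) (hU : f ∈ U ↔ f ∈ U') (hUe : f ∈ U → e < f)
    (h : f ∉ U → (ActiveAt M A U f ↔ ActiveAt M A' U' f) ∧
      (DualObstructedAt N A U f ↔ DualObstructedAt N A' U' f)) :
    stageFactor M N x u y v U A f = stageFactor M N x u y v U' A' f := by
  classical
  have hset : f ∈ U → Set.Ioi f ∩ (A : Set E) = Set.Ioi f ∩ A' := by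
    intro hf
    ext g
    simp only [Set.mem_inter_iff, Set.mem_Ioi, Finset.mem_coe]
    refine and_congr_right fun hg => hA g ?_
    rintro rfl
    exact lt_asymm hg (hUe hf)
  by_cases hf : f ∈ U
  · simp only [stageFactor, hf, hU.1 hf, if_true, activeAt_Ioi_iff, dualObstructedAt_Ioi_iff,
      hset hf, hA f hfe]
  · have hf' : f ∉ U' := fun h' => hf (hU.2 h')
    simp only [stageFactor, hf, hf', if_false, (h hf).1, (h hf).2, hA f hfe]

/-- If `e` is a loop of the minor of `M` or a coloop of the minor of `N`, its deletion and its
contraction have the same activities. -/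
theorem deletion_eq_contraction {E : Type*} [LinearOrder E] [Finite E] {M N : OrientedMatroid E}
    (hMN : M.IsPerspective N) {A : Finset E} {e : E} (heA : e ∉ A)
    (h : ActiveAt M A (Set.Ioi e) e ∨ ¬DualObstructedAt N A (Set.Ioi e) e) {f : E} (hf : f < e) :
    (ActiveAt M A (Set.Ici e) f ↔ ActiveAt M (insert e A) (Set.Ici e) f) ∧
    (DualObstructedAt N A (Set.Ici e) f ↔ DualObstructedAt N (insert e A) (Set.Ici e) f) := by
  have hAB : ∀ g, g ≠ e → (g ∈ A ↔ g ∈ insert e A) := fun g hg => by simp [hg]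
  rcases h with h | h
  · rw [activeAt_Ioi_iff, M.mem_closure_iff_exists_circuit fun h => lt_irrefl e h.1] at h
    obtain ⟨X, hX, hXe, hX0⟩ := h
    obtain ⟨Y, hY, hYe, hYX⟩ := hMN.exists_conformal hX hXe
    have hX0' : ∀ g, g ≠ e → g ∉ Set.Ioi e ∩ (A : Set E) → X g = 0 := fun g hge hg => by
      by_contra h
      exact hg (hX0 g h hge)
    refine ⟨(activeAt_congr_of_loop heA hX hXe hX0' hf).1,
      (activeAt_congr_of_loop heA hY hYe (fun g hge hg => ?_) hf).2⟩
    exact (hYX g).elim id fun h => h.trans (hX0' g hge hg)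
  · have hN : ∀ Y ∈ N.circuits, (∀ g ∈ Set.Ioi e \ (A : Set E), Y g = 0) → Y e = 0 := by
      intro Y hY hY0
      by_contra hYe
      rw [dualObstructedAt_Ioi_iff] at h
      refine h (N.mem_closure_of_circuit hY hYe fun g hg hge => ?_)
      rcases lt_or_gt_of_ne hge with hlt | hlt
      · exact Or.inl hlt
      · refine Or.inr ⟨hlt, ?_⟩
        by_contra hgA
        exact hg (hY0 g ⟨hlt, hgA⟩)
    have hM : ∀ X ∈ M.circuits, (∀ g ∈ Set.Ioi e \ (A : Set E), X g = 0) → X e = 0 := by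
      intro X hX hX0
      by_contra hXe
      obtain ⟨Y, hY, hYe, hYX⟩ := hMN.exists_conformal hX hXe
      exact hYe (hN Y hY fun g hg => (hYX g).elim id fun h => h.trans (hX0 g hg))
    obtain ⟨s1, s2, s3, s4, s5, s6⟩ := stage_sets heA
    simp only [ActiveAt, DualObstructedAt, s3, s4, s5, s6, Set.union_insert]
    exact ⟨hits_congr_of_coloop (fun X hX hX0 => hM X hX fun g hg => hX0 g (Or.inr hg)) hAB,
      hits_congr_of_coloop hN hAB⟩

/-- Replacing the two orientations of the greatest remaining element `e` by its deletion and its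
contraction preserves the sum of the weights. -/
theorem prod_stageFactor_add {E : Type*} [LinearOrder E] [Fintype E] {R : Type*} [CommRing R]
    {M N : OrientedMatroid E} (hMN : M.IsPerspective N) (x u y v : R) {U A : Finset E} {e : E}
    (hU : (U : Set E) = Set.Ioi e) (heA : e ∉ A) :
    ∏ f, stageFactor M N x u y v U A f + ∏ f, stageFactor M N x u y v U (insert e A) f =
      ∏ f, stageFactor M N x u y v (insert e U) A f +
        ∏ f, stageFactor M N x u y v (insert e U) (insert e A) f := by
  classical
  have hU' : ((insert e U : Finset E) : Set E) = Set.Ici e := by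
    rw [Finset.coe_insert, hU, Set.Ioi_insert]
  have hmem : ∀ f, f ∈ U ↔ e < f := fun f => by rw [← Finset.mem_coe, hU, Set.mem_Ioi]
  have heU : e ∉ U := by simp [hmem]
  obtain ⟨s1, -, -, -, -, -⟩ := stage_sets heA
  have hAA : ∀ g, g ≠ e → (g ∈ A ↔ g ∈ A) := fun g hg => Iff.rfl
  have hAB : ∀ g, g ≠ e → (g ∈ A ↔ g ∈ insert e A) := fun g hg => by simp [hg]
  have hBA : ∀ g, g ≠ e → (g ∈ insert e A ↔ g ∈ A) := fun g hg => (hAB g hg).symm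
  have hBB : ∀ g, g ≠ e → (g ∈ insert e A ↔ g ∈ insert e A) := fun g hg => Iff.rfl
  have congr : ∀ {V V' C C' : Finset E}, (V = U ∨ V = insert e U) → (V' = U ∨ V' = insert e U) →
      (∀ g, g ≠ e → (g ∈ C ↔ g ∈ C')) →
      (∀ f < e, (ActiveAt M C V f ↔ ActiveAt M C' V' f) ∧
        (DualObstructedAt N C V f ↔ DualObstructedAt N C' V' f)) →
      ∏ f ∈ Finset.univ.erase e, stageFactor M N x u y v V C f =
        ∏ f ∈ Finset.univ.erase e, stageFactor M N x u y v V' C' f := by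
    intro V V' C C' hV hV' hC h
    refine Finset.prod_congr rfl fun f hf => ?_
    have hfe : f ≠ e := Finset.ne_of_mem_erase hf
    have hfV : f ∈ V ↔ e < f := by rcases hV with rfl | rfl <;> simp [hmem, hfe]
    have hfV' : f ∈ V' ↔ e < f := by rcases hV' with rfl | rfl <;> simp [hmem, hfe]
    refine stageFactor_congr hfe hC (hfV.trans hfV'.symm) hfV.1 fun hn => h f ?_
    exact lt_of_le_of_ne (not_lt.1 fun h' => hn (hfV.2 h')) hfe
  have hact : ActiveAt M (insert e A) (Set.Ioi e) e ↔ ActiveAt M A (Set.Ioi e) e := by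
    rw [activeAt_Ioi_iff, activeAt_Ioi_iff, s1]
  have hobs : DualObstructedAt N (insert e A) (Set.Ioi e) e ↔
      DualObstructedAt N A (Set.Ioi e) e := by
    rw [dualObstructedAt_Ioi_iff, dualObstructedAt_Ioi_iff, s1]
  have hloop : ActiveAt M A (Set.Ioi e) e → DualObstructedAt N A (Set.Ioi e) e := by
    intro h
    rw [activeAt_Ioi_iff, M.mem_closure_iff_exists_circuit fun h => lt_irrefl e h.1] at h
    obtain ⟨X, hX, hXe, hX0⟩ := h
    obtain ⟨Y, hY, hYe, hYX⟩ := hMN.exists_conformal hX hXe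
    rw [dualObstructedAt_Ioi_iff]
    refine N.mem_closure_of_circuit hY hYe fun g hg hge => Or.inr (hX0 g ?_ hge)
    rcases hYX g with h | h
    · exact absurd h hg
    · rwa [← h]
  have hpair := orientation_pair_eq_minor_pair hMN heA rfl
  rw [← hU', ← hU] at hpair
  have hprod := hpair.imp
    (fun h => And.intro
      (congr (Or.inl rfl) (Or.inr rfl) hAA fun f hf => ⟨(h f hf).1, (h f hf).2.2.1⟩)
      (congr (Or.inl rfl) (Or.inr rfl) hBB fun f hf => ⟨(h f hf).2.1, (h f hf).2.2.2⟩))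
    (fun h => And.intro
      (congr (Or.inl rfl) (Or.inr rfl) hAB fun f hf => ⟨(h f hf).1, (h f hf).2.2.1⟩)
      (congr (Or.inl rfl) (Or.inr rfl) hBA fun f hf => ⟨(h f hf).2.1, (h f hf).2.2.2⟩))
  have hequal : ActiveAt M A (Set.Ioi e) e ∨ ¬DualObstructedAt N A (Set.Ioi e) e →
      ∏ f ∈ Finset.univ.erase e, stageFactor M N x u y v (insert e U) A f =
        ∏ f ∈ Finset.univ.erase e, stageFactor M N x u y v (insert e U) (insert e A) f := by
    intro h
    refine congr (Or.inr rfl) (Or.inr rfl) hAB fun f hf => ?_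
    rw [hU']
    exact deletion_eq_contraction hMN heA h hf
  simp only [← Finset.mul_prod_erase Finset.univ _ (Finset.mem_univ e)]
  generalize ∏ f ∈ Finset.univ.erase e, stageFactor M N x u y v U A f = a at *
  generalize ∏ f ∈ Finset.univ.erase e, stageFactor M N x u y v U (insert e A) f = b at *
  generalize ∏ f ∈ Finset.univ.erase e, stageFactor M N x u y v (insert e U) A f = c at *
  generalize ∏ f ∈ Finset.univ.erase e, stageFactor M N x u y v (insert e U) (insert e A) f = d at *
  simp only [stageFactor, heU, if_false, heA, hU, Finset.mem_insert_self, if_true, hact, hobs]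
  by_cases hl : ActiveAt M A (Set.Ioi e) e
  · obtain rfl := hequal (Or.inl hl)
    simp only [hl, hloop hl, if_true]
    rcases hprod with ⟨rfl, rfl⟩ | ⟨rfl, rfl⟩ <;> ring
  by_cases hc : DualObstructedAt N A (Set.Ioi e) e
  · simp only [hl, hc, if_true, if_false]
    rcases hprod with ⟨rfl, rfl⟩ | ⟨rfl, rfl⟩ <;> ring
  · obtain rfl := hequal (Or.inr hc)
    simp only [hl, hc, if_false]
    rcases hprod with ⟨rfl, rfl⟩ | ⟨rfl, rfl⟩ <;> ring

/-- The total weight does not depend on the upper set of elements already removed. -/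
theorem sum_prod_stageFactor {E : Type*} [LinearOrder E] [Fintype E] {R : Type*} [CommRing R]
    {M N : OrientedMatroid E} (hMN : M.IsPerspective N) (x u y v : R) (U : Finset E)
    (hU : IsUpperSet (U : Set E)) :
    ∑ A, ∏ f, stageFactor M N x u y v ∅ A f = ∑ A, ∏ f, stageFactor M N x u y v U A f := by
  induction U using Finset.induction_on_min with
  | empty => rfl
  | insert e U he ih =>
    have heq : (U : Set E) = Set.Ioi e := by
      ext g
      refine ⟨fun hg => he g hg, fun hg => ?_⟩
      have := hU (le_of_lt hg) (Finset.mem_coe.2 (Finset.mem_insert_self e U))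
      exact (Finset.mem_insert.1 this).resolve_left (ne_of_gt hg)
    rw [ih (by rw [heq]; exact isUpperSet_Ioi e), ← Finset.powerset_univ,
      ← Finset.insert_erase (Finset.mem_univ e), Finset.sum_powerset_insert (by simp),
      Finset.sum_powerset_insert (by simp), ← Finset.sum_add_distrib, ← Finset.sum_add_distrib]
    refine Finset.sum_congr rfl fun A hA => ?_
    rw [Finset.insert_erase (Finset.mem_univ e)]
    exact prod_stageFactor_add hMN x u y v heq fun h =>
      Finset.notMem_erase e _ (Finset.mem_powerset.1 hA h)

/-! ### The two ends of the summation -/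

theorem activeAt_empty_iff {E : Type*} [LinearOrder E] [Fintype E] {M : OrientedMatroid E}
    {A : Finset E} {f : E} : ActiveAt M A ((∅ : Finset E) : Set E) f ↔ f ∈ (M.reorient A).active := by
  have hleast : f ∈ (M.reorient A).active ↔ ∃ X ∈ M.circuits,
      SignedPositive (signedReorient A X) ∧ IsLeast (Function.support X) f := by
    simp only [active, Finset.mem_filter, Finset.mem_univ, true_and]
    simp only [reorient, Set.exists_mem_image, support_signedReorient]
  rw [hleast]
  refine exists_congr fun X => and_congr_right fun _ => ?_
  simp only [Fits, Finset.coe_empty, Set.empty_inter, Set.empty_sdiff, Set.union_empty]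
  constructor
  · rintro ⟨h1, h2, h3⟩
    exact ⟨fun g => h3 g (Set.notMem_empty g), h1, fun g hg => not_lt.1 fun h => hg (h2 g h)⟩
  · rintro ⟨h1, h2, h3⟩
    exact ⟨h2, fun g hg => by_contra fun h => not_le.2 hg (h3 h), fun g _ => h1 g⟩

theorem dualObstructedAt_empty_iff {E : Type*} [LinearOrder E] [Fintype E] {N : OrientedMatroid E}
    {A : Finset E} {f : E} :
    DualObstructedAt N A ((∅ : Finset E) : Set E) f ↔ f ∉ (N.reorient A).dualActive := by
  simp only [mem_dualActive_iff, reorient, Set.forall_mem_image, DualObstructedAt, Hits, Fits,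
    Finset.coe_empty, Set.empty_inter, Set.empty_sdiff, Set.union_empty, Set.mem_empty_iff_false,
    false_imp_iff, implies_true, true_and, Set.mem_Iio, not_lt]
  push Not
  refine exists_congr fun X => and_congr_right fun _ => ⟨fun ⟨h1, h2⟩ => ?_, fun ⟨h1, h2⟩ => ?_⟩
  · refine ⟨?_, fun g hg => h2 g hg.le⟩
    rcases SignType.trichotomy (signedReorient A X f) with h | h | h
    · exact absurd h (h2 f le_rfl)
    · exact absurd ((signedReorient_zero_iff A X f).1 h) h1
    · exact h
  · refine ⟨fun h => ?_, fun g hg => ?_⟩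
    · rw [(signedReorient_zero_iff A X f).2 h] at h1
      exact absurd h1 (by decide)
    · rcases hg.eq_or_lt with rfl | hg
      · rw [h1]; decide
      · exact h2 g hg

theorem prod_ite_mem_ite_mem {E : Type*} [Fintype E] [DecidableEq E] {R : Type*} [CommRing R]
    (S A : Finset E) (y v : R) :
    ∏ f, (if f ∈ S then if f ∈ A then v else y else 1) =
      y ^ (S \ A).card * v ^ (S ∩ A).card := by
  rw [Fintype.prod_ite_mem, Finset.prod_ite, Finset.prod_const, Finset.prod_const,
    Finset.filter_mem_eq_inter, Finset.filter_notMem_eq_sdiff, mul_comm]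

theorem prod_stageFactor_empty {E : Type*} [LinearOrder E] [Fintype E] {R : Type*} [CommRing R]
    (M N : OrientedMatroid E) (x u y v : R) (A : Finset E) :
    ∏ f, stageFactor M N x u y v ∅ A f =
      x ^ (N.thetaStar A).card * u ^ (N.thetaStarBar A).card *
        y ^ (M.theta A).card * v ^ (M.thetaBar A).card := by
  classical
  have : ∀ f, stageFactor M N x u y v ∅ A f =
      (if f ∈ (M.reorient A).active then if f ∈ A then v else y else 1) *
        if f ∈ (N.reorient A).dualActive then if f ∈ A then u else x else 1 := by
    intro f
    simp only [stageFactor, activeAt_empty_iff, dualObstructedAt_empty_iff, Finset.notMem_empty,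
      if_false, ite_not]
  simp only [this, Finset.prod_mul_distrib, prod_ite_mem_ite_mem, theta, thetaBar, thetaStar,
    thetaStarBar]
  ring

open scoped Classical in
theorem rk_insert {E : Type*} [Finite E] (M : OrientedMatroid E) (e : E) (S : Set E) :
    M.rk (insert e S) = M.rk S + if e ∈ M.toMatroid.closure S then 0 else 1 := by
  split_ifs with h
  · rw [add_zero, rk, rk, ← Matroid.eRk_closure_eq, Matroid.closure_insert_eq_of_mem_closure h,
      Matroid.eRk_closure_eq]
  · have hfin : M.toMatroid.eRk S ≠ ⊤ :=
      ((M.toMatroid.eRk_le_encard S).trans_lt (Set.toFinite S).encard_lt_top).ne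
    rw [rk, rk, Matroid.eRk_insert_eq_add_one ⟨Set.mem_univ e, h⟩, ENat.toNat_add hfin (by simp)]
    rfl

open scoped Classical in
/-- The nullity counts the elements that are loops when they are contracted in decreasing order. -/
theorem card_filter_add_rk {E : Type*} [LinearOrder E] [Finite E] (M : OrientedMatroid E)
    (s : Finset E) :
    (s.filter fun f => f ∈ M.toMatroid.closure (Set.Ioi f ∩ s)).card + M.rk s = s.card := by
  induction s using Finset.induction_on_min with
  | empty =>
    simp only [Finset.filter_empty, Finset.card_empty, zero_add, Finset.coe_empty, rk]
    simp
  | insert a s ha ih =>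
    have has : a ∉ s := fun h => lt_irrefl a (ha a h)
    have h1 : Set.Ioi a ∩ ((insert a s : Finset E) : Set E) = s := by
      ext g
      simp only [Finset.coe_insert, Set.mem_inter_iff, Set.mem_Ioi, Set.mem_insert_iff,
        Finset.mem_coe]
      exact ⟨fun h => h.2.resolve_left (ne_of_gt h.1), fun h => ⟨ha g h, Or.inr h⟩⟩
    have h2 : s.filter (fun f => f ∈ M.toMatroid.closure
        (Set.Ioi f ∩ ((insert a s : Finset E) : Set E))) =
        s.filter fun f => f ∈ M.toMatroid.closure (Set.Ioi f ∩ s) := by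
      refine Finset.filter_congr fun f hf => ?_
      rw [Finset.coe_insert, Set.inter_insert_of_notMem fun h : a ∈ Set.Ioi f => lt_asymm h (ha f hf)]
    rw [Finset.filter_insert, h1, h2, Finset.coe_insert, rk_insert,
      Finset.card_insert_of_notMem has, ← ih]
    split_ifs with h
    · rw [Finset.card_insert_of_notMem (by simp [has])]; ring
    · ring

open scoped Classical in
/-- The corank counts the elements that are coloops when they are deleted in decreasing order. -/
theorem rk_union_eq_add_card_filter {E : Type*} [LinearOrder E] [Finite E] (N : OrientedMatroid E)
    (A s : Finset E) (hs : IsLowerSet (s : Set E)) :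
    N.rk (A ∪ s : Set E) = N.rk A + (s.filter fun f =>
      f ∉ A ∧ f ∉ N.toMatroid.closure (Set.Iio f ∪ Set.Ioi f ∩ A)).card := by
  induction s using Finset.induction_on_max with
  | empty => simp
  | insert a s ha ih =>
    have has : a ∉ s := fun h => lt_irrefl a (ha a h)
    have heq : (s : Set E) = Set.Iio a := by
      ext g
      refine ⟨fun hg => ha g hg, fun hg => ?_⟩
      have := hs (le_of_lt hg) (Finset.mem_coe.2 (Finset.mem_insert_self a s))
      exact (Finset.mem_insert.1 this).resolve_left (ne_of_lt hg)
    have ih := ih (by rw [heq]; exact isLowerSet_Iio a)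
    rw [Finset.coe_insert, Set.union_insert, Finset.filter_insert]
    by_cases haA : a ∈ A
    · rw [Set.insert_eq_of_mem (Set.mem_union_left _ haA), if_neg (by simp [haA]), ih]
    · have hset : (A ∪ s : Set E) = Set.Iio a ∪ Set.Ioi a ∩ A := by
        rw [heq]
        ext g
        rcases lt_trichotomy g a with h | h | h
        · simp [h]
        · simp [h, haA]
        · simp [h, or_comm]
      rw [rk_insert, ih, hset]
      by_cases h : a ∈ N.toMatroid.closure (Set.Iio a ∪ Set.Ioi a ∩ A)
      · simp [h]
      · rw [if_neg h, if_pos ⟨haA, h⟩, Finset.card_insert_of_notMem (by simp [has])]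
        ring

theorem prod_stageFactor_univ {E : Type*} [LinearOrder E] [Fintype E] {R : Type*} [CommRing R]
    (M N : OrientedMatroid E) (x u y v : R) (A : Finset E) :
    ∏ f, stageFactor M N x u y v Finset.univ A f =
      (x + u - 1) ^ (N.rk Set.univ - N.rk (A : Set E)) *
        (y + v - 1) ^ (A.card - M.rk (A : Set E)) := by
  classical
  have hnull := M.card_filter_add_rk A
  have hcorank := N.rk_union_eq_add_card_filter A Finset.univ (by simp [isLowerSet_univ])
  rw [Finset.coe_univ, Set.union_univ] at hcorank
  rw [← hnull, hcorank, Nat.add_sub_cancel, Nat.add_sub_cancel_left, ← Finset.prod_const,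
    ← Finset.prod_const, Finset.prod_filter, Finset.prod_filter, ← Fintype.prod_ite_mem A,
    ← Finset.prod_mul_distrib]
  refine Finset.prod_congr rfl fun f _ => ?_
  simp only [stageFactor, Finset.mem_univ, if_true, activeAt_Ioi_iff, dualObstructedAt_Ioi_iff]
  by_cases hf : f ∈ A
  · simp [hf]
  · by_cases h : f ∈ N.toMatroid.closure (Set.Iio f ∪ Set.Ioi f ∩ A) <;> simp [hf, h]

end OrientedMatroid

/-- The four-variable expansion of the Tutte polynomial of an oriented matroid perspective in terms
of refined orientation activities, as an identity valid in every commutative ring (in particular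
in polynomial rings, with indeterminates for `x`, `u`, `y`, `v`). -/
theorem mainTheorem1 {E : Type*} [Fintype E] [LinearOrder E] (M N : OrientedMatroid E)
    (hMN : M.IsPerspective N) {R : Type*} [CommRing R] (x u y v : R) :
    OrientedMatroid.tutte M N (x + u) (y + v) 1 =
      ∑ A : Finset E,
        x ^ (N.thetaStar A).card * u ^ (N.thetaStarBar A).card *
          y ^ (M.theta A).card * v ^ (M.thetaBar A).card := by
  simp only [OrientedMatroid.tutte, one_pow, mul_one,
    ← OrientedMatroid.prod_stageFactor_univ, ← OrientedMatroid.prod_stageFactor_empty]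
  exact (OrientedMatroid.sum_prod_stageFactor hMN x u y v Finset.univ
    (by simp [isUpperSet_univ])).symm
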